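/- Let $\mathbb G$ be a Carnot group: a connected, simply connected Lie group whose Lie algebra has a stratification $\mathfrak g=V_1\oplus\cdots\oplus V_s$, $[V_1,V_i]=V_{i+1}$, $V_s\neq 0$, $V_k=0$ for $k>s$. Fix a basis $X_1,\dots,X_n$ of $\mathfrak g$ adapted to the stratification, with dual basis $\theta_1,\dots,\theta_n$, and the metric for which it is orthonormal. Let $w(\theta_j)=i$ if $X_j\in V_i$, let $\theta_{j_1}\wedge\cdots\wedge\theta_{j_h}$ have weight $w(\theta_{j_1})+\cdots+w(\theta_{j_h})$, and let $Q=\sum_j w(\theta_j)$. Let $\Omega^*$ be the smooth forms on $\mathbb G$, $\Omega^{p,*}$ those of pure weight $p$ (combinations, with smooth coefficients, of left-invariant forms of weight $p$), $(\alpha)_p$ the component of weight $p$ of $\alpha$, $F_p=\bigoplus_{a\ge p}\Omega^{a,*}$, and let $d_i$ be the part of the de Rham differential $d$ that raises the weight by $i$. Let $d_0^{-1}$ be the operator, acting pointwise, that sends a covector $\beta$ to the unique $\alpha\perp\ker d_0$ with $d_0\alpha-\beta\perp \operatorname{im}d_0$. Put $E_0=\ker d_0\cap(\operatorname{im}d_0)^\perp$,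 $E_0^h=E_0\cap\Omega^h$, $\Pi_{E_0}=\mathrm{Id}-d_0d_0^{-1}-d_0^{-1}d_0$, $P=\sum_{k=0}^{Q}(-1)^k[d_0^{-1}(d-d_0)]^k$, $\Pi_E=\mathrm{Id}-dPd_0^{-1}-Pd_0^{-1}d$, $d_c=\Pi_{E_0}d\,\Pi_E$, and $$\zeta_j=\sum_{m=1}^{j}(-1)^{m-1}\sum_{\substack{i_1,\dots,i_m\ge1\\ i_1+\cdots+i_m=j}}(d_0^{-1}d_{i_1})\cdots(d_0^{-1}d_{i_m}),\qquad D_r=d_r-\sum_{i=1}^{r-1}d_i\,\zeta_{r-i}.$$ For $r\ge1$ and $p\in\mathbb Z$ let $Z_r^{p,*}$ be the space of $x\in\Omega^{p,*}$ with $d_0x=0$ for which there are $z_{p+j}\in\Omega^{p+j,*}$, $1\le j\le r-1$, with $$(\star)\qquad d_mx=\sum_{i=0}^{m-1}d_iz_{p+m-i}\quad(1\le m\le r-1),$$ and let $B_r^{p,*}$ be the space of sums $\sum_{k=0}^{r-1}d_kc_{p-k}$ with $c_{p-k}\in\Omega^{p-k,*}$ and $\sum_{k=l}^{r-1}d_{k-l}c_{p-k}=0$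 for $1\le l\le r-1$. Let $E_r^{p,*}=\mathcal Z_r^{p}/\mathcal B_r^{p}$, with $\mathcal Z_r^p=F_p\cap d^{-1}F_{p+r}$, $\mathcal B_r^p=\mathcal Z_{r-1}^{p+1}+d\mathcal Z_{r-1}^{p-r+1}$ and differential $[x]\mapsto[dx]$, be the $r$-th page of the spectral sequence of the filtration $F$. Then: 1. $[d_0^{-1}(d-d_0)]^{Q+1}=0$, $\Pi_{E_0}$ takes values in $E_0$, and $d_c$ maps $E_0^h$ to $E_0^{h+1}$ for every $h$. 2. On $E_0$ one has $d_c=\Pi_{E_0}\sum_{r=1}^{N}D_r$ for every $N\ge Q$, and for $r\ge 1$ and $\alpha\in E_0\cap\Omega^{p,*}$ the component of weight $p+r$ of $d_c\alpha$ is $\Pi_{E_0}D_r\alpha$. 3. For every $r\ge1$ and all $p$, $[x]\mapsto[(x)_p]$ is a well-defined isomorphism $E_r^{p,*}\to Z_r^{p,*}/B_r^{p,*}$. Let $\partial_r:Z_r^{p,*}/B_r^{p,*}\to Z_r^{p+r,*}/B_r^{p+r,*}$ be the differential of the $r$-th page read through these isomorphisms. If $x\in\Omega^{p,*}$, $d_0x=0$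 and the $z_{p+j}$ satisfy $(\star)$, then $\partial_r[x]=[d_rx-\sum_{i=1}^{r-1}d_iz_{p+r-i}]$. If moreover all $z_{p+j}\perp\ker d_0$, then $z_{p+j}=\zeta_jx$ for $1\le j\le r-1$, and $$\partial_r[x]=[D_rx].$$ This applies, with $z_{p+j}=\zeta_j\alpha$, to every $\alpha\in E_0\cap\Omega^{p,*}$ with $d_c\alpha\in F_{p+r}$. 4. For every $r\ge 1$ and all $p$, the whole of $\partial_r$ is induced by $d_c$: if $y\in E_0\cap F_p$ and $d_cy\in F_{p+r}$, then $(y)_p\in Z_r^{p,*}$, $(d_cy)_{p+r}\in Z_r^{p+r,*}$ and $\partial_r[(y)_p]=[(d_cy)_{p+r}]$; and every class in $Z_r^{p,*}/B_r^{p,*}$ is $[(y)_p]$ for such a $y$. Thus the operators $D_r$ whose sum over $r\ge1$ gives $d_c$ on the subspace $E_0$ (up to $\Pi_{E_0}$) are those that give the differentials $\partial_r$ on the quotients $Z_r/B_r\cong E_r$. -/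

import Mathlib

open scoped Manifold ContDiff Topology

noncomputable section
namespace Carnot

section Geometry
variable {E : Type*} [NormedAddCommGroup E] [NormedSpace ℝ E]
  {G : Type*} [TopologicalSpace G] [ChartedSpace E G] [Group G]

/-- `h`-covectors on the model space `E`. The Lie algebra of a Lie group modelled on `E` is its
tangent space at the identity, which is (a synonym of) `E`, so `Covec E h` is `Λ^h 𝔤*`. -/
abbrev Covec (E : Type*) [NormedAddCommGroup E] [NormedSpace ℝ E] (h : ℕ) : Type _ :=
  E [⋀^Fin h]→L[ℝ] ℝ

instance instChartedSpaceCovec (h : ℕ) : ChartedSpace (Covec E h) (Covec E h) :=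
  chartedSpaceSelf _

/-- Smooth differential `h`-forms on a Lie group, written in the left-invariant trivialisation
`Γ(Λ^h T*G) = C^∞(G, Λ^h 𝔤*)`: the value at `x` of the form given by `α` is the covector
`α x ∘ (dL_x)⁻¹` on `T_x G`. Left-invariant forms are the constant functions. -/
abbrev Form (E : Type*) [NormedAddCommGroup E] [NormedSpace ℝ E]
    (G : Type*) [TopologicalSpace G] [ChartedSpace E G] (h : ℕ) : Type _ :=
  ContMDiffMap 𝓘(ℝ, E) 𝓘(ℝ, Covec E h) G (Covec E h) ∞

/-- The differential at `1` of `k ↦ x * k` read in the chart at `x₀`. It sends `v ∈ 𝔤` to the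
coordinate vector at `x` of the left-invariant vector field generated by `v`. -/
def leftFrame (x₀ x : G) : E →L[ℝ] E :=
  mfderiv 𝓘(ℝ, E) 𝓘(ℝ, E) (fun k : G => extChartAt 𝓘(ℝ, E) x₀ (x * k)) 1

/-- The coordinate expression, in the chart at `x₀`, of the differential form given by `α`:
the pullback of `x ↦ α x ∘ (dL_x)⁻¹` under the inverse chart. -/
def chartForm {h : ℕ} (α : G → Covec E h) (x₀ : G) (y : E) : Covec E h :=
  (α ((extChartAt 𝓘(ℝ, E) x₀).symm y)).compContinuousLinearMap
    (leftFrame x₀ ((extChartAt 𝓘(ℝ, E) x₀).symm y)).inverse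

/-- The exterior derivative: in the chart at `x` it is the exterior derivative `extDeriv` of the
coordinate expression, carried back to the left-invariant trivialisation. It may be computed in any
other chart, see `dFun_eq`. -/
def dFun {h : ℕ} (α : G → Covec E h) (x : G) : Covec E (h + 1) :=
  (extDeriv (chartForm α x) (extChartAt 𝓘(ℝ, E) x x)).compContinuousLinearMap (leftFrame x x)

/-- Evaluation of a covector on all tuples of vectors of a basis. -/
def evalBasis {ι : Type*} (b : Module.Basis ι ℝ E) (h : ℕ) :
    Covec E h →ₗ[ℝ] ((Fin h → ι) → ℝ) where
  toFun ξ J := ξ (fun i => b (J i))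
  map_add' _ _ := rfl
  map_smul' _ _ := rfl

theorem evalBasis_injective {ι : Type*} [Finite ι] (b : Module.Basis ι ℝ E) (h : ℕ) :
    Function.Injective (evalBasis b h) := by
  intro ξ η he
  have hm : ξ.toMultilinearMap = η.toMultilinearMap :=
    Module.Basis.ext_multilinear (fun _ => b) (fun J => congrFun he J)
  ext v
  exact congrArg (fun m => m v) hm

instance instFiniteCovec [FiniteDimensional ℝ E] (h : ℕ) : FiniteDimensional ℝ (Covec E h) :=
  Module.Finite.of_injective _ (evalBasis_injective (Module.finBasis ℝ E) h)

theorem contDiffAt_comp_covec [FiniteDimensional ℝ E] {D : Type*} [NormedAddCommGroup D]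
    [NormedSpace ℝ D] {h : ℕ} {f : D → Covec E h} {g : D → E →L[ℝ] E} {y : D}
    (hf : ContDiffAt ℝ ∞ f y) (hg : ContDiffAt ℝ ∞ g y) :
    ContDiffAt ℝ ∞ (fun y => (f y).compContinuousLinearMap (g y)) y := by
  let b := Module.finBasis ℝ E
  obtain ⟨L, hL⟩ := LinearMap.exists_leftInverse_of_injective (evalBasis b h)
    (LinearMap.ker_eq_bot.2 (evalBasis_injective b h))
  have key : ContDiffAt ℝ ∞ (fun y => evalBasis b h ((f y).compContinuousLinearMap (g y))) y := by
    rw [contDiffAt_pi]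
    intro J
    have h1 : ContDiffAt ℝ ∞ (fun y =>
        ContinuousMultilinearMap.compContinuousLinearMapContinuousMultilinear ℝ
          (fun _ : Fin h => E) (fun _ => E) ℝ (fun _ => g y)
          (ContinuousAlternatingMap.toContinuousMultilinearMapCLM ℝ (f y))) y := by
      refine ContDiffAt.clm_apply ?_ ?_
      · exact (ContinuousMultilinearMap.contDiff _).contDiffAt.comp y
          (contDiffAt_pi.2 fun _ => hg)
      · exact (ContinuousLinearMap.contDiff _).contDiffAt.comp y hf
    exact (ContinuousMultilinearMap.apply ℝ (fun _ : Fin h => E) ℝ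
      (fun i => b (J i))).contDiff.contDiffAt.comp y h1
  have : (fun y => (f y).compContinuousLinearMap (g y)) = fun y => LinearMap.toContinuousLinearMap L
      (evalBasis b h ((f y).compContinuousLinearMap (g y))) := by
    funext y
    exact (LinearMap.congr_fun hL _).symm
  rw [this]
  exact (ContinuousLinearMap.contDiff _).contDiffAt.comp y key

theorem contDiffAt_extDeriv {h : ℕ} {η : E → Covec E h} {y : E} (hη : ContDiffAt ℝ ∞ η y) :
    ContDiffAt ℝ ∞ (extDeriv η) y := by
  have : extDeriv η = fun y =>
      ContinuousAlternatingMap.alternatizeUncurryFinCLM ℝ E ℝ (fderiv ℝ η y) := rfl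
  rw [this]
  exact (ContinuousLinearMap.contDiff _).contDiffAt.comp y (hη.fderiv_right (by simp))

variable [LieGroup 𝓘(ℝ, E) ∞ G]

theorem mdiffAt_chart_mul (x₀ x k : G) (hx : x * k ∈ (extChartAt 𝓘(ℝ, E) x₀).source) :
    MDifferentiableAt 𝓘(ℝ, E) 𝓘(ℝ, E) (fun k : G => extChartAt 𝓘(ℝ, E) x₀ (x * k)) k := by
  have h1 : MDifferentiableAt 𝓘(ℝ, E) 𝓘(ℝ, E) (extChartAt 𝓘(ℝ, E) x₀) (x * k) :=
    (contMDiffAt_extChartAt' (n := ∞) (by simpa using hx)).mdifferentiableAt (by simp)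
  have h2 : MDifferentiableAt 𝓘(ℝ, E) 𝓘(ℝ, E) (fun k : G => x * k) k :=
    (contMDiff_mul_left (I := 𝓘(ℝ, E)) (n := ∞) (a := x)).contMDiffAt.mdifferentiableAt (by simp)
  exact h1.comp k h2

theorem contDiffAt_transition (x₀ x₁ : G) {y : E} (hy : y ∈ (extChartAt 𝓘(ℝ, E) x₀).target)
    (h1 : (extChartAt 𝓘(ℝ, E) x₀).symm y ∈ (extChartAt 𝓘(ℝ, E) x₁).source) :
    ContDiffAt ℝ ∞ (extChartAt 𝓘(ℝ, E) x₁ ∘ (extChartAt 𝓘(ℝ, E) x₀).symm) y := by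
  have := contDiffWithinAt_ext_coord_change (I := 𝓘(ℝ, E)) (n := ∞) x₁ x₀ (y := y)
    (by rw [PartialEquiv.trans_source]; exact ⟨hy, h1⟩)
  rwa [modelWithCornersSelf_coe, Set.range_id, contDiffWithinAt_univ] at this

theorem leftFrame_trans (x₀ x₁ x : G) (h0 : x ∈ (extChartAt 𝓘(ℝ, E) x₀).source)
    (h1 : x ∈ (extChartAt 𝓘(ℝ, E) x₁).source) :
    leftFrame (E := E) x₁ x = (fderiv ℝ (extChartAt 𝓘(ℝ, E) x₁ ∘ (extChartAt 𝓘(ℝ, E) x₀).symm)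
      (extChartAt 𝓘(ℝ, E) x₀ x)).comp (leftFrame x₀ x) := by
  have hf := mdiffAt_chart_mul (E := E) x₀ x 1 (by simpa using h0)
  have hτ := (contDiffAt_transition (E := E) x₀ x₁ ((extChartAt 𝓘(ℝ, E) x₀).map_source h0)
    (by rwa [(extChartAt 𝓘(ℝ, E) x₀).left_inv h0])).differentiableAt (by simp)
  have hev : (fun k : G => extChartAt 𝓘(ℝ, E) x₁ (x * k)) =ᶠ[𝓝 1]
      ((extChartAt 𝓘(ℝ, E) x₁ ∘ (extChartAt 𝓘(ℝ, E) x₀).symm) ∘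
        fun k : G => extChartAt 𝓘(ℝ, E) x₀ (x * k)) := by
    have hc : ContinuousAt (fun k : G => x * k) 1 :=
      (contMDiff_mul_left (I := 𝓘(ℝ, E)) (n := ∞) (a := x)).continuous.continuousAt
    have : (extChartAt 𝓘(ℝ, E) x₀).source ∈ 𝓝 (x * 1) := by
      rw [mul_one]; exact extChartAt_source_mem_nhds' h0
    filter_upwards [hc this] with k hk
    simp only [Function.comp]
    rw [(extChartAt 𝓘(ℝ, E) x₀).left_inv hk]
  have hτ' : MDifferentiableAt 𝓘(ℝ, E) 𝓘(ℝ, E)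
      (extChartAt 𝓘(ℝ, E) x₁ ∘ (extChartAt 𝓘(ℝ, E) x₀).symm)
      (extChartAt 𝓘(ℝ, E) x₀ (x * 1)) := by
    rw [mul_one]; exact hτ.mdifferentiableAt
  have h3 := hev.mfderiv_eq (I := 𝓘(ℝ, E)) (I' := 𝓘(ℝ, E))
  have h4 := mfderiv_comp (I := 𝓘(ℝ, E)) (I' := 𝓘(ℝ, E)) (I'' := 𝓘(ℝ, E)) (1 : G)
    (f := fun k : G => extChartAt 𝓘(ℝ, E) x₀ (x * k)) hτ' hf
  unfold leftFrame
  refine (h3.trans h4).trans ?_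
  rw [mfderiv_eq_fderiv]
  simp only [mul_one]
  rfl

theorem leftFrame_isInvertible (x₀ x : G) (h0 : x ∈ (extChartAt 𝓘(ℝ, E) x₀).source) :
    (leftFrame (E := E) x₀ x).IsInvertible := by
  have h1 : MDifferentiableAt 𝓘(ℝ, E) 𝓘(ℝ, E) (extChartAt 𝓘(ℝ, E) x₀) (x * 1) :=
    (contMDiffAt_extChartAt' (n := ∞) (by simpa using h0)).mdifferentiableAt (by simp)
  have hd : ∀ a k : G, MDifferentiableAt 𝓘(ℝ, E) 𝓘(ℝ, E) (fun k : G => a * k) k := fun a k =>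
    (contMDiff_mul_left (I := 𝓘(ℝ, E)) (n := ∞) (a := a)).contMDiffAt.mdifferentiableAt (by simp)
  have h4 := mfderiv_comp (I := 𝓘(ℝ, E)) (I' := 𝓘(ℝ, E)) (I'' := 𝓘(ℝ, E)) (1 : G)
    (f := fun k : G => x * k) h1 (hd x 1)
  have e1 : (mfderiv 𝓘(ℝ, E) 𝓘(ℝ, E) (extChartAt 𝓘(ℝ, E) x₀) (x * 1)).IsInvertible :=
    isInvertible_mfderiv_extChartAt (by simpa using h0)
  have e2 : (mfderiv 𝓘(ℝ, E) 𝓘(ℝ, E) (fun k : G => x * k) 1).IsInvertible := by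
    have A : mfderiv 𝓘(ℝ, E) 𝓘(ℝ, E) ((fun k : G => x⁻¹ * k) ∘ (fun k : G => x * k)) 1 =
        ContinuousLinearMap.id _ _ := by
      have : (fun k : G => x⁻¹ * k) ∘ (fun k : G => x * k) = id := by ext k; simp
      rw [this, id_eq, mfderiv_id]
    have B : mfderiv 𝓘(ℝ, E) 𝓘(ℝ, E) ((fun k : G => x * k) ∘ (fun k : G => x⁻¹ * k)) (x * 1) =
        ContinuousLinearMap.id _ _ := by
      have : (fun k : G => x * k) ∘ (fun k : G => x⁻¹ * k) = id := by ext k; simp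
      rw [this, id_eq, mfderiv_id]
    rw [mfderiv_comp (I' := 𝓘(ℝ, E)) _ (hd _ _) (hd _ _)] at A
    rw [mfderiv_comp (I' := 𝓘(ℝ, E)) _ (hd _ _) (hd _ _), inv_mul_cancel_left] at B
    exact ContinuousLinearMap.IsInvertible.of_inverse B A
  unfold leftFrame
  have := e1.comp e2
  rw [← h4] at this
  exact this

theorem contDiffOn_leftFrame (x₀ : G) :
    ContDiffOn ℝ ∞ (fun y => leftFrame (E := E) x₀ ((extChartAt 𝓘(ℝ, E) x₀).symm y))
      (extChartAt 𝓘(ℝ, E) x₀).target := by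
  set φ := extChartAt 𝓘(ℝ, E) x₀ with hφ
  set φ₁ := extChartAt 𝓘(ℝ, E) (1 : G) with hφ₁
  have hop : IsOpen φ.target := isOpen_extChartAt_target x₀
  have hop1 : IsOpen φ₁.target := isOpen_extChartAt_target (1 : G)
  have hF : ∀ y ∈ φ.target, ContDiffAt ℝ ∞
      (Function.uncurry fun (y u : E) => φ (φ.symm y * φ₁.symm u)) (y, φ₁ 1) := by
    intro y hy
    rw [← contMDiffAt_iff_contDiffAt]
    have m1 : ContMDiffAt 𝓘(ℝ, E) 𝓘(ℝ, E) ∞ φ.symm y :=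
      (contMDiffOn_extChartAt_symm x₀).contMDiffAt (hop.mem_nhds hy)
    have m2 : ContMDiffAt 𝓘(ℝ, E) 𝓘(ℝ, E) ∞ φ₁.symm (φ₁ 1) :=
      (contMDiffOn_extChartAt_symm (1 : G)).contMDiffAt
        (hop1.mem_nhds (mem_extChartAt_target (1 : G)))
    have f1 : ContMDiffAt 𝓘(ℝ, E × E) 𝓘(ℝ, E) ∞ (fun q : E × E => φ.symm q.1) (y, φ₁ 1) :=
      ContMDiffAt.comp (y, φ₁ 1) m1 contDiff_fst.contMDiff.contMDiffAt
    have f2 : ContMDiffAt 𝓘(ℝ, E × E) 𝓘(ℝ, E) ∞ (fun q : E × E => φ₁.symm q.2) (y, φ₁ 1) :=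
      ContMDiffAt.comp (y, φ₁ 1) m2 contDiff_snd.contMDiff.contMDiffAt
    have f3 := f1.mul f2
    have hv : φ.symm y * φ₁.symm (φ₁ 1) = φ.symm y := by
      rw [hφ₁, extChartAt_to_inv, mul_one]
    have m3 : ContMDiffAt 𝓘(ℝ, E) 𝓘(ℝ, E) ∞ φ (φ.symm y * φ₁.symm (φ₁ 1)) := by
      rw [hv]
      exact contMDiffAt_extChartAt' (by simpa [hφ] using φ.map_target hy)
    exact ContMDiffAt.comp (y, φ₁ 1) m3 f3
  have heq : ∀ y ∈ φ.target, leftFrame (E := E) x₀ (φ.symm y) =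
      fderiv ℝ (fun u : E => φ (φ.symm y * φ₁.symm u)) (φ₁ 1) := by
    intro y hy
    have hm := mdiffAt_chart_mul (E := E) x₀ (φ.symm y) 1
      (by simpa [hφ] using φ.map_target hy)
    refine (hm.mfderiv).trans ?_
    rw [modelWithCornersSelf_coe, Set.range_id, fderivWithin_univ]
    rfl
  intro y hy
  have : ContDiffAt ℝ ∞ (fun y => fderiv ℝ (fun u : E => φ (φ.symm y * φ₁.symm u)) (φ₁ 1)) y :=
    ContDiffAt.fderiv (hF y hy) contDiffAt_const (by simp)
  refine (this.contDiffWithinAt).congr (fun z hz => heq z hz) (heq y hy)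

variable [FiniteDimensional ℝ E]

theorem contDiffOn_chartForm {h : ℕ} (α : Form E G h) (x₀ : G) :
    ContDiffOn ℝ ∞ (chartForm α x₀) (extChartAt 𝓘(ℝ, E) x₀).target := by
  intro y hy
  have hop := isOpen_extChartAt_target (I := 𝓘(ℝ, E)) x₀
  have := FiniteDimensional.complete ℝ E
  refine ContDiffAt.contDiffWithinAt ?_
  refine contDiffAt_comp_covec ?_ ?_
  · rw [← contMDiffAt_iff_contDiffAt]
    exact ContMDiffAt.comp y α.contMDiff.contMDiffAt
      ((contMDiffOn_extChartAt_symm x₀).contMDiffAt (hop.mem_nhds hy))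
  · exact ContDiffAt.comp y (leftFrame_isInvertible x₀ _
      ((extChartAt 𝓘(ℝ, E) x₀).map_target hy)).contDiffAt_map_inverse
      ((contDiffOn_leftFrame x₀).contDiffAt (hop.mem_nhds hy))

theorem contDiffAt_chartForm {h : ℕ} (α : Form E G h) (x₀ : G) {y : E}
    (hy : y ∈ (extChartAt 𝓘(ℝ, E) x₀).target) : ContDiffAt ℝ ∞ (chartForm α x₀) y :=
  (contDiffOn_chartForm α x₀).contDiffAt ((isOpen_extChartAt_target x₀).mem_nhds hy)

theorem dFun_eq {h : ℕ} (α : Form E G h) (x₀ x : G) (h0 : x ∈ (extChartAt 𝓘(ℝ, E) x₀).source) :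
    dFun α x = (extDeriv (chartForm α x₀) (extChartAt 𝓘(ℝ, E) x₀ x)).compContinuousLinearMap
      (leftFrame x₀ x) := by
  set φ := extChartAt 𝓘(ℝ, E) x₀ with hφ
  set ψ := extChartAt 𝓘(ℝ, E) x with hψ
  have hx : x ∈ ψ.source := mem_extChartAt_source x
  have hxt : ψ x ∈ ψ.target := mem_extChartAt_target x
  have hτx : (φ ∘ ψ.symm) (ψ x) = φ x := by simp [ψ.left_inv hx]
  have hopt : IsOpen ψ.target := isOpen_extChartAt_target x
  have hsrc : ∀ᶠ y in 𝓝 (ψ x), y ∈ ψ.target ∧ ψ.symm y ∈ φ.source := by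
    have hc : ContinuousAt ψ.symm (ψ x) := continuousAt_extChartAt_symm x
    have : φ.source ∈ 𝓝 (ψ.symm (ψ x)) := by
      rw [ψ.left_inv hx]; exact extChartAt_source_mem_nhds' h0
    exact Filter.Eventually.and (hopt.mem_nhds hxt) (hc this)
  have hev : chartForm α x =ᶠ[𝓝 (ψ x)] fun y =>
      (chartForm α x₀ ((φ ∘ ψ.symm) y)).compContinuousLinearMap (fderiv ℝ (φ ∘ ψ.symm) y) := by
    filter_upwards [hsrc] with y hy
    have e1 : φ.symm ((φ ∘ ψ.symm) y) = ψ.symm y := φ.left_inv hy.2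
    have e2 := leftFrame_trans (E := E) x x₀ (ψ.symm y) (ψ.map_target hy.1) hy.2
    have e3 : ψ (ψ.symm y) = y := ψ.right_inv hy.1
    have i1 := leftFrame_isInvertible (E := E) x (ψ.symm y) (ψ.map_target hy.1)
    have i2 := leftFrame_isInvertible (E := E) x₀ (ψ.symm y) hy.2
    rw [← hφ, ← hψ, e3] at e2
    have e4 : (leftFrame (E := E) x₀ (ψ.symm y)).inverse.comp (fderiv ℝ (φ ∘ ψ.symm) y) =
        (leftFrame (E := E) x (ψ.symm y)).inverse := by
      ext v
      obtain ⟨w, rfl⟩ := i1.surjective v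
      have : fderiv ℝ (φ ∘ ψ.symm) y (leftFrame x (ψ.symm y) w) = leftFrame x₀ (ψ.symm y) w := by
        rw [e2]; rfl
      simp [this, i1.inverse_apply_self, i2.inverse_apply_self]
    unfold chartForm
    rw [← hφ, ← hψ, e1, ← e4]
    rfl
  have hpb : extDeriv (fun y => (chartForm α x₀ ((φ ∘ ψ.symm) y)).compContinuousLinearMap
      (fderiv ℝ (φ ∘ ψ.symm) y)) (ψ x) = (extDeriv (chartForm α x₀)
      ((φ ∘ ψ.symm) (ψ x))).compContinuousLinearMap (fderiv ℝ (φ ∘ ψ.symm) (ψ x)) :=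
    extDeriv_pullback (r := ∞)
    (by rw [hτx]; exact (contDiffAt_chartForm α x₀ (φ.map_source h0)).differentiableAt (by simp))
    (contDiffAt_transition x x₀ hxt (by rw [ψ.left_inv hx]; exact h0)) (by simpa using ENat.LEInfty.out)
  unfold dFun
  rw [← hψ, hev.extDeriv_eq, hpb, hτx, leftFrame_trans (E := E) x x₀ x hx h0]
  rfl

theorem contMDiff_dFun {h : ℕ} (α : Form E G h) :
    ContMDiff 𝓘(ℝ, E) 𝓘(ℝ, Covec E (h + 1)) ∞ (dFun α) := by
  intro x₀
  set φ := extChartAt 𝓘(ℝ, E) x₀ with hφ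
  have hxt : φ x₀ ∈ φ.target := mem_extChartAt_target x₀
  have hop : IsOpen φ.target := isOpen_extChartAt_target x₀
  have h1 : ContDiffAt ℝ ∞ (fun y => (extDeriv (chartForm α x₀) y).compContinuousLinearMap
      (leftFrame x₀ (φ.symm y))) (φ x₀) :=
    contDiffAt_comp_covec (contDiffAt_extDeriv (contDiffAt_chartForm α x₀ hxt))
      ((contDiffOn_leftFrame x₀).contDiffAt (hop.mem_nhds hxt))
  have h2 : ContMDiffAt 𝓘(ℝ, E) 𝓘(ℝ, Covec E (h + 1)) ∞ (fun x =>
      (extDeriv (chartForm α x₀) (φ x)).compContinuousLinearMap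
      (leftFrame x₀ (φ.symm (φ x)))) x₀ :=
    ContMDiffAt.comp x₀ h1.contMDiffAt contMDiffAt_extChartAt
  refine h2.congr_of_eventuallyEq ?_
  filter_upwards [extChartAt_source_mem_nhds (I := 𝓘(ℝ, E)) x₀] with x hx
  rw [dFun_eq α x₀ x hx, ← hφ, φ.left_inv hx]

/-- The de Rham differential `d : Ω^h → Ω^{h+1}`. -/
def deRham (h : ℕ) : Form E G h →ₗ[ℝ] Form E G (h + 1) where
  toFun α := ⟨dFun α, contMDiff_dFun α⟩
  map_add' α β := by
    ext1 x
    have hx := mem_extChartAt_target (I := 𝓘(ℝ, E)) x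
    have e : chartForm (⇑(α + β)) x = chartForm α x + chartForm β x := by
      funext y; ext v; rfl
    change dFun (⇑(α + β)) x = dFun α x + dFun β x
    unfold dFun
    rw [e, extDeriv_add ((contDiffAt_chartForm α x hx).differentiableAt (by simp))
      ((contDiffAt_chartForm β x hx).differentiableAt (by simp))]
    rfl
  map_smul' c α := by
    ext1 x
    have e : chartForm (⇑(c • α)) x = c • chartForm α x := by
      funext y; ext v; rfl
    change dFun (⇑(c • α)) x = c • dFun α x
    unfold dFun
    rw [e, extDeriv_smul]
    rfl

theorem deRham_deRham {h : ℕ} (α : Form E G h) :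
    deRham (E := E) (G := G) (h + 1) (deRham (E := E) (G := G) h α) = 0 := by
  ext1 x
  set φ := extChartAt 𝓘(ℝ, E) x with hφ
  have hxt : φ x ∈ φ.target := mem_extChartAt_target x
  have hop : IsOpen φ.target := isOpen_extChartAt_target x
  have hev : chartForm (dFun α) x =ᶠ[𝓝 (φ x)] extDeriv (chartForm α x) := by
    filter_upwards [hop.mem_nhds hxt] with y hy
    have i := leftFrame_isInvertible (E := E) x (φ.symm y) (φ.map_target hy)
    unfold chartForm
    rw [← hφ, dFun_eq α x _ (φ.map_target hy), ← hφ, φ.right_inv hy]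
    ext v
    simp only [ContinuousAlternatingMap.compContinuousLinearMap_apply, Function.comp_def,
      i.self_apply_inverse]
    rfl
  change dFun (dFun α) x = 0
  unfold dFun
  rw [show (fun x => (extDeriv (chartForm (⇑α) x) (extChartAt 𝓘(ℝ, E) x x)).compContinuousLinearMap
    (leftFrame x x)) = dFun α from rfl, ← hφ, hev.extDeriv_eq,
    extDeriv_extDeriv_apply (contDiffAt_chartForm α x hxt) (by simpa using ENat.LEInfty.out)]
  rfl

end Geometry

section SpectralSequence
variable {M : Type*} [AddCommGroup M] [Module ℝ M]

/-- The class of `x ∈ Z` in `Z / (B ∩ Z)`. -/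
def cls (Z B : Submodule ℝ M) (x : M) (hx : x ∈ Z) : ↥Z ⧸ B.submoduleOf Z :=
  Submodule.Quotient.mk ⟨x, hx⟩

/-- The `r`-cycles `F_p ∩ d⁻¹(F_{p+r})` of a differential `d` with a decreasing filtration `F`. -/
def cycles (d : Module.End ℝ M) (F : ℤ → Submodule ℝ M) (r : ℕ) (p : ℤ) : Submodule ℝ M :=
  F p ⊓ (F (p + r)).comap d

/-- The `r`-boundaries of a differential with a decreasing filtration. -/
def boundaries (d : Module.End ℝ M) (F : ℤ → Submodule ℝ M) : ℕ → ℤ → Submodule ℝ M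
  | 0, p => cycles d F 0 (p + 1)
  | r + 1, p => cycles d F r (p + 1) ⊔ (cycles d F r (p - r)).map d

/-- The term `E_r^{p,*}` of the spectral sequence of a filtered complex. -/
abbrev Page (d : Module.End ℝ M) (F : ℤ → Submodule ℝ M) (r : ℕ) (p : ℤ) : Type _ :=
  ↥(cycles d F r p) ⧸ (boundaries d F r p).submoduleOf (cycles d F r p)

theorem map_cycles (d : Module.End ℝ M) (hd : ∀ x, d (d x) = 0) (F : ℤ → Submodule ℝ M)
    (r : ℕ) (p : ℤ) : ∀ x ∈ cycles d F r p, d x ∈ cycles d F r (p + r) := by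
  intro x hx
  refine ⟨hx.2, ?_⟩
  simp [hd]

theorem map_boundaries (d : Module.End ℝ M) (hd : ∀ x, d (d x) = 0) (F : ℤ → Submodule ℝ M)
    (r : ℕ) (p : ℤ) : ∀ x ∈ boundaries d F r p, d x ∈ boundaries d F r (p + r) := by
  intro x hx
  cases r with
  | zero =>
    have h := map_cycles d hd F 0 (p + 1) x hx
    simpa [boundaries] using h
  | succ r =>
    obtain ⟨u, hu, v, ⟨c, _, rfl⟩, rfl⟩ := Submodule.mem_sup.1 hx
    refine Submodule.mem_sup_right ⟨u, ?_, by simp [hd]⟩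
    have e : p + ((r + 1 : ℕ) : ℤ) - r = p + 1 := by push_cast; ring
    rw [e]
    exact hu

/-- The differential of the `r`-th page, `[x] ↦ [d x]`. -/
def pageDiff (d : Module.End ℝ M) (hd : ∀ x, d (d x) = 0) (F : ℤ → Submodule ℝ M)
    (r : ℕ) (p : ℤ) : Page d F r p →ₗ[ℝ] Page d F r (p + r) :=
  Submodule.mapQ _ _ (d.restrict (map_cycles d hd F r p))
    (fun x hx => map_boundaries d hd F r p x hx)

end SpectralSequence

section LieAlgebra
variable (E : Type*) [NormedAddCommGroup E] [NormedSpace ℝ E]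
  (G : Type*) [TopologicalSpace G] [ChartedSpace E G] [Group G]

/-- A stratification `𝔤 = V_1 ⊕ ⋯ ⊕ V_s`, `[V_1, V_i] = V_{i+1}`, `V_s ≠ 0`, `V_k = 0` for `k > s`,
of the Lie algebra of a Lie group. -/
structure Stratification where
  layer : ℕ → Submodule ℝ (GroupLieAlgebra 𝓘(ℝ, E) G)
  step : ℕ
  isInternal : DirectSum.IsInternal layer
  layer_zero : layer 0 = ⊥
  bracket_mem : ∀ (i j : ℕ) (X Y : GroupLieAlgebra 𝓘(ℝ, E) G),
    X ∈ layer i → Y ∈ layer j → ⁅X, Y⁆ ∈ layer (i + j)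
  layer_succ : ∀ i : ℕ, 1 ≤ i → layer (i + 1) =
    Submodule.span ℝ {Z | ∃ X ∈ layer 1, ∃ Y ∈ layer i, Z = ⁅X, Y⁆}
  layer_step : layer step ≠ ⊥
  layer_of_gt : ∀ k : ℕ, step < k → layer k = ⊥

variable {E G}

/-- A basis `X_1, …, X_n` of the Lie algebra adapted to the stratification: `X_i` lies in the layer
`V_{w i}`. The metric is the left-invariant one for which this basis is orthonormal; the metrics
obtained in this way are all those for which the layers are pairwise orthogonal. -/
structure AdaptedBasis (S : Stratification E G) (n : ℕ) where
  basis : Module.Basis (Fin n) ℝ (GroupLieAlgebra 𝓘(ℝ, E) G)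
  weight : Fin n → ℕ
  mem_layer : ∀ i, basis i ∈ S.layer (weight i)

end LieAlgebra

section Covectors
variable {E : Type*} [NormedAddCommGroup E] [NormedSpace ℝ E] {n : ℕ}

/-- Strictly increasing multi-indices `j_1 < ⋯ < j_h`. -/
def incr (h n : ℕ) : Finset (Fin h → Fin n) :=
  open Classical in Finset.univ.filter StrictMono

/-- `θ_{j_1} ∧ ⋯ ∧ θ_{j_h}` for the basis `θ` dual to `b`. -/
def wedge [FiniteDimensional ℝ E] (b : Module.Basis (Fin n) ℝ E) {h : ℕ} (J : Fin h → Fin n) : Covec E h :=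
  { (Matrix.detRowAlternating (R := ℝ) (n := Fin h)).compLinearMap
      (LinearMap.pi fun i => b.coord (J i)) with
    cont := by
      change Continuous fun v : Fin h → E =>
        Matrix.det (Matrix.of fun i j => b.coord (J j) (v i))
      refine Continuous.matrix_det (continuous_matrix fun i j => ?_)
      exact (LinearMap.continuous_of_finiteDimensional (b.coord (J j))).comp (continuous_apply i) }

/-- The inner product of `h`-covectors for which the `θ_{j_1} ∧ ⋯ ∧ θ_{j_h}`, `j_1 < ⋯ < j_h`,
are orthonormal. -/
def covInner (b : Module.Basis (Fin n) ℝ E) (h : ℕ) : LinearMap.BilinForm ℝ (Covec E h) :=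
  LinearMap.mk₂ ℝ (fun ξ η => ∑ J ∈ incr h n, ξ (fun i => b (J i)) * η (fun i => b (J i)))
    (fun _ _ _ => by simp [add_mul, Finset.sum_add_distrib])
    (fun _ _ _ => by simp [Finset.mul_sum, mul_assoc])
    (fun _ _ _ => by simp [mul_add, Finset.sum_add_distrib])
    (fun _ _ _ => by simp [Finset.mul_sum, mul_left_comm])

theorem eq_zero_of_incr (b : Module.Basis (Fin n) ℝ E) {h : ℕ} (ξ : Covec E h)
    (hξ : ∀ J ∈ incr h n, ξ (fun i => b (J i)) = 0) : ξ = 0 := by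
  apply evalBasis_injective b h
  rw [map_zero]
  funext J
  change ξ (fun i => b (J i)) = 0
  by_cases hJ : Function.Injective J
  · have hs : StrictMono (J ∘ Tuple.sort J) :=
      (Tuple.monotone_sort J).strictMono_of_injective (hJ.comp (Tuple.sort J).injective)
    have h0 := hξ (J ∘ Tuple.sort J) (by simp [incr, hs])
    have h1 := ξ.toAlternatingMap.map_perm (fun i => b (J i)) (Tuple.sort J)
    have h2 : ξ.toAlternatingMap ((fun i => b (J i)) ∘ Tuple.sort J) = 0 := h0
    rw [h2] at h1
    rcases Int.units_eq_one_or (Equiv.Perm.sign (Tuple.sort J)) with hu | hu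
    · rw [hu] at h1
      simpa using h1.symm
    · rw [hu] at h1
      simpa using h1.symm
  · obtain ⟨i, j, hij, hne⟩ : ∃ i j, J i = J j ∧ i ≠ j := by
      simpa [Function.Injective] using hJ
    exact ξ.map_eq_zero_of_eq _ (by simp [hij]) hne

theorem isCompl_orthogonal [FiniteDimensional ℝ E] (b : Module.Basis (Fin n) ℝ E) (h : ℕ) (W : Submodule ℝ (Covec E h)) :
    IsCompl W ((covInner b h).orthogonal W) := by
  have hr : (covInner b h).IsRefl := by
    intro ξ η he
    rw [← he]
    simp [covInner, mul_comm]
  rw [LinearMap.BilinForm.isCompl_orthogonal_iff_disjoint hr, Submodule.disjoint_def]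
  intro ξ h1 h2
  have h3 : ∑ J ∈ incr h n, ξ (fun i => b (J i)) * ξ (fun i => b (J i)) = 0 := h2 ξ h1
  rw [Finset.sum_eq_zero_iff_of_nonneg (fun _ _ => mul_self_nonneg _)] at h3
  exact eq_zero_of_incr b ξ fun J hJ => mul_self_eq_zero.1 (h3 J hJ)

/-- The component of weight `a` of an `h`-covector, `θ_{j_1} ∧ ⋯ ∧ θ_{j_h}` having weight
`w j_1 + ⋯ + w j_h`. -/
def covProj [FiniteDimensional ℝ E] (b : Module.Basis (Fin n) ℝ E) (w : Fin n → ℕ) (h : ℕ)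
    (a : ℤ) : Covec E h →ₗ[ℝ] Covec E h where
  toFun ξ := ∑ J ∈ (incr h n).filter (fun J => ∑ i, (w (J i) : ℤ) = a),
    ξ (fun i => b (J i)) • wedge b J
  map_add' _ _ := by simp [add_smul, Finset.sum_add_distrib]
  map_smul' _ _ := by simp [mul_smul, Finset.smul_sum]

/-- The inverse of `f : V → W` with respect to inner products: it sends `β` to the unique
`α ∈ (ker f)^⊥` with `f α - β ∈ (im f)^⊥`. It is the composite of the orthogonal projection onto
`im f`, the inverse of `V / ker f ≅ im f`, and `V / ker f ≅ (ker f)^⊥`. -/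
def partialInverse [FiniteDimensional ℝ E] {h k : ℕ} (b : Module.Basis (Fin n) ℝ E)
    (f : Covec E h →ₗ[ℝ] Covec E k) : Covec E k →ₗ[ℝ] Covec E h :=
  ((covInner b h).orthogonal (LinearMap.ker f)).subtype ∘ₗ
    (Submodule.quotientEquivOfIsCompl _ _
      (isCompl_orthogonal b h (LinearMap.ker f))).toLinearMap ∘ₗ
    f.quotKerEquivRange.symm.toLinearMap ∘ₗ
    Submodule.projectionOnto _ _ (isCompl_orthogonal b k (LinearMap.range f))

end Covectors

section TotalComplex
variable (E : Type*) [NormedAddCommGroup E] [NormedSpace ℝ E]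
  (G : Type*) [TopologicalSpace G] [ChartedSpace E G]

/-- All smooth forms `Ω^* = ⨁_h Ω^h`. As `Ω^h = 0` for `h > dim G`, the sum is the product. -/
def Forms : Type _ := (h : ℕ) → Form E G h

instance : AddCommGroup (Forms E G) := inferInstanceAs (AddCommGroup ((h : ℕ) → Form E G h))

instance : Module ℝ (Forms E G) := inferInstanceAs (Module ℝ ((h : ℕ) → Form E G h))

variable {E G}

/-- Forms that are homogeneous of degree `h`. -/
def Forms.degree (h : ℕ) : Submodule ℝ (Forms E G) where
  carrier := {α | ∀ k, k ≠ h → α k = 0}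
  zero_mem' _ _ := rfl
  add_mem' {α β} ha hb k hk := by
    change α k + β k = 0
    rw [ha k hk, hb k hk, add_zero]
  smul_mem' c α ha k hk := by
    change c • α k = 0
    rw [ha k hk, smul_zero]

/-- The operator of degree `1` on `Ω^*` with components `T h : Ω^h → Ω^{h+1}`. -/
def Forms.raise (T : ∀ h, Form E G h →ₗ[ℝ] Form E G (h + 1)) : Module.End ℝ (Forms E G) :=
  { toFun := fun α h => match h with
      | 0 => 0
      | k + 1 => T k (α k)
    map_add' := fun α β => by
      funext h
      cases h with
      | zero => exact (add_zero _).symm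
      | succ k => exact (T k).map_add (α k) (β k)
    map_smul' := fun c α => by
      funext h
      cases h with
      | zero => exact (smul_zero c).symm
      | succ k => exact (T k).map_smul c (α k) }

/-- The operator of degree `-1` on `Ω^*` with components `T h : Ω^{h+1} → Ω^h`. -/
def Forms.lower (T : ∀ h, Form E G (h + 1) →ₗ[ℝ] Form E G h) : Module.End ℝ (Forms E G) :=
  { toFun := fun α h => T h (α (h + 1))
    map_add' := fun α β => funext fun h => (T h).map_add (α (h + 1)) (β (h + 1))
    map_smul' := fun c α => funext fun h => (T h).map_smul c (α (h + 1)) }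

/-- The operator of degree `0` on `Ω^*` with components `T h : Ω^h → Ω^h`. -/
def Forms.keep (T : ∀ h, Form E G h →ₗ[ℝ] Form E G h) : Module.End ℝ (Forms E G) :=
  { toFun := fun α h => T h (α h)
    map_add' := fun α β => funext fun h => (T h).map_add (α h) (β h)
    map_smul' := fun c α => funext fun h => (T h).map_smul c (α h) }

variable [FiniteDimensional ℝ E]

/-- A linear map of covectors acting pointwise on forms. -/
def pointwise {h k : ℕ} (T : Covec E h →ₗ[ℝ] Covec E k) : Form E G h →ₗ[ℝ] Form E G k where
  toFun α := ⟨fun x => T (α x),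
    (LinearMap.toContinuousLinearMap T).contMDiff.comp α.contMDiff⟩
  map_add' α β := by ext1 x; exact T.map_add (α x) (β x)
  map_smul' c α := by ext1 x; exact T.map_smul c (α x)

variable [Group G] [LieGroup 𝓘(ℝ, E) ∞ G]

variable (E G) in
/-- The de Rham differential on `Ω^*`. -/
def d : Module.End ℝ (Forms E G) := Forms.raise deRham

theorem d_d (α : Forms E G) : d E G (d E G α) = 0 := by
  funext h
  match h with
  | 0 => rfl
  | 1 => exact (deRham (E := E) (G := G) 0).map_zero
  | h + 2 => exact deRham_deRham (α h)

variable (E G) in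
/-- The action of `d` on left-invariant `h`-forms, as a map `Λ^h 𝔤* → Λ^{h+1} 𝔤*`. -/
def covD0 (h : ℕ) : Covec E h →ₗ[ℝ] Covec E (h + 1) where
  toFun ξ := deRham (E := E) (G := G) h ⟨fun _ => ξ, contMDiff_const⟩ 1
  map_add' ξ η := by
    exact congrArg (fun β : Form E G (h + 1) => β 1)
      ((deRham (E := E) (G := G) h).map_add ⟨fun _ => ξ, contMDiff_const⟩
        ⟨fun _ => η, contMDiff_const⟩)
  map_smul' c ξ := by
    exact congrArg (fun β : Form E G (h + 1) => β 1)
      ((deRham (E := E) (G := G) h).map_smul c ⟨fun _ => ξ, contMDiff_const⟩)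

namespace AdaptedBasis
variable {S : Stratification E G} {n : ℕ} (A : AdaptedBasis S n)

/-- The adapted basis, as a basis of the model space `E = T_1 G`. -/
def frame : Module.Basis (Fin n) ℝ E := A.basis

/-- The homogeneous dimension `Q`, the largest weight of a form. -/
def homDim : ℕ := ∑ i, A.weight i

/-- The component `(α)_a` of weight `a` of a form. -/
def wproj (a : ℤ) : Module.End ℝ (Forms E G) :=
  Forms.keep fun h => pointwise (covProj A.frame A.weight h a)

/-- The forms of pure weight `a`, that is `Ω^{a,*}`. -/
def weightForms (a : ℤ) : Submodule ℝ (Forms E G) := LinearMap.range (A.wproj a)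

/-- The filtration by weights: the forms of weight at least `p`. -/
def filtration (p : ℤ) : Submodule ℝ (Forms E G) :=
  ⨅ a : ℤ, ⨅ _ : a < p, LinearMap.ker (A.wproj a)

/-- The part `d_i` of the de Rham differential that increases the weight by `i`. -/
def dW (i : ℕ) : Module.End ℝ (Forms E G) :=
  ∑ a ∈ Finset.range (A.homDim + 1), A.wproj ((a : ℤ) + i) * d E G * A.wproj a

/-- Pointwise orthogonality of forms. -/
def Ortho (α β : Forms E G) : Prop :=
  ∀ (h : ℕ) (x : G), covInner A.frame h (α h x) (β h x) = 0

/-- The operator `d_0⁻¹`. -/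
def d0inv : Module.End ℝ (Forms E G) :=
  Forms.lower fun h => pointwise (partialInverse A.frame (covD0 E G h))

/-- The Rumin forms `E_0 = ker d_0 ∩ (im d_0)^⊥`. -/
def ruminForms : Submodule ℝ (Forms E G) where
  carrier := {α | A.dW 0 α = 0 ∧ ∀ β, A.Ortho α (A.dW 0 β)}
  zero_mem' := ⟨map_zero _, fun β h x => LinearMap.map_zero₂ _ _⟩
  add_mem' {α α'} ha hb := ⟨by rw [map_add, ha.1, hb.1, add_zero], fun β h x => by
    change covInner A.frame h (α h x + α' h x) (A.dW 0 β h x) = 0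
    rw [LinearMap.map_add₂, ha.2 β h x, hb.2 β h x, add_zero]⟩
  smul_mem' c α ha := ⟨by rw [map_smul, ha.1, smul_zero], fun β h x => by
    change covInner A.frame h (c • α h x) (A.dW 0 β h x) = 0
    rw [LinearMap.map_smul₂, ha.2 β h x, smul_zero]⟩

/-- `Π_{E_0} = Id - d_0 d_0⁻¹ - d_0⁻¹ d_0`. -/
def projE0 : Module.End ℝ (Forms E G) := 1 - A.dW 0 * A.d0inv - A.d0inv * A.dW 0

/-- The operator `d_0⁻¹ (d - d_0)`. It increases the weight, and all weights lie in `{0, …, Q}`. -/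
def nilOp : Module.End ℝ (Forms E G) := A.d0inv * (d E G - A.dW 0)

/-- `P = ∑_k (-1)^k [d_0⁻¹ (d - d_0)]^k`; the terms with `k > Q` vanish. -/
def P : Module.End ℝ (Forms E G) :=
  ∑ k ∈ Finset.range (A.homDim + 1), (-1 : ℝ) ^ k • A.nilOp ^ k

/-- `Π_E = Id - d P d_0⁻¹ - P d_0⁻¹ d`. -/
def projE : Module.End ℝ (Forms E G) := 1 - d E G * A.P * A.d0inv - A.P * A.d0inv * d E G

/-- The Rumin differential `d_c = Π_{E_0} d Π_E`. -/
def dc : Module.End ℝ (Forms E G) := A.projE0 * d E G * A.projE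

/-- `∑_I (d_0⁻¹ d_{i_1}) ⋯ (d_0⁻¹ d_{i_m})` over the `I = (i_1, …, i_m)` with positive entries and
`i_1 + ⋯ + i_m = j`. -/
def words (m j : ℕ) : Module.End ℝ (Forms E G) :=
  ∑ I ∈ (Finset.Nat.antidiagonalTuple m j).filter (fun I => ∀ k, 1 ≤ I k),
    (List.ofFn fun k => A.d0inv * A.dW (I k)).prod

/-- `∑_{m=1}^j (-1)^{m-1} ∑_{|I| = j} (d_0⁻¹ d)_I`. -/
def zOp (j : ℕ) : Module.End ℝ (Forms E G) :=
  ∑ m ∈ Finset.Icc 1 j, (-1 : ℝ) ^ (m - 1) • A.words m j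

/-- `D_r = d_r - ∑_{i=1}^{r-1} d_i ∑_{m=1}^{r-i} (-1)^{m-1} ∑_{|I| = r-i} (d_0⁻¹ d)_I`. -/
def diffPart (r : ℕ) : Module.End ℝ (Forms E G) :=
  A.dW r - ∑ i ∈ Finset.Ico 1 r, A.dW i * A.zOp (r - i)

/-- `z` is a system of forms `z_{p+j}` of weight `p + j`, `1 ≤ j ≤ r - 1`, exhibiting `x` as an
element of `Z_r^{p,*}`. -/
def IsZigzag (r : ℕ) (p : ℤ) (x : Forms E G) (z : ℕ → Forms E G) : Prop :=
  (∀ j, 1 ≤ j → j < r → z j ∈ A.weightForms (p + j)) ∧ A.dW 0 x = 0 ∧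
    ∀ m, 1 ≤ m → m < r → A.dW m x = ∑ i ∈ Finset.range m, A.dW i (z (m - i))

/-- The submodule `Z_r^{p,*}` of `Ω^{p,*}`. -/
def Z (r : ℕ) (p : ℤ) : Submodule ℝ (Forms E G) where
  carrier := {x | x ∈ A.weightForms p ∧ ∃ z, A.IsZigzag r p x z}
  zero_mem' := ⟨Submodule.zero_mem _, 0, fun _ _ _ => Submodule.zero_mem _, map_zero _,
    fun _ _ _ => by simp⟩
  add_mem' := by
    rintro x y ⟨hx, z, h1, h2, h3⟩ ⟨hy, z', h1', h2', h3'⟩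
    refine ⟨Submodule.add_mem _ hx hy, z + z', fun j a b => Submodule.add_mem _ (h1 j a b)
      (h1' j a b), by rw [map_add, h2, h2', add_zero], fun m a b => ?_⟩
    rw [map_add, h3 m a b, h3' m a b, ← Finset.sum_add_distrib]
    simp
  smul_mem' := by
    rintro c x ⟨hx, z, h1, h2, h3⟩
    refine ⟨Submodule.smul_mem _ c hx, c • z, fun j a b => Submodule.smul_mem _ c (h1 j a b),
      by rw [map_smul, h2, smul_zero], fun m a b => ?_⟩
    rw [map_smul, h3 m a b, Finset.smul_sum]
    simp

/-- The submodule `B_r^{p,*}` of `Ω^{p,*}`: the `x = ∑_{k=0}^{r-1} d_k c_{p-k}`, with `c_{p-k}` of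
weight `p - k`, such that `∑_{k=l}^{r-1} d_{k-l} c_{p-k} = 0` for `1 ≤ l ≤ r - 1`. -/
def B (r : ℕ) (p : ℤ) : Submodule ℝ (Forms E G) where
  carrier := {x | ∃ c : ℕ → Forms E G, (∀ k, k < r → c k ∈ A.weightForms (p - k)) ∧
    x = ∑ k ∈ Finset.range r, A.dW k (c k) ∧
    ∀ l, 1 ≤ l → l < r → 0 = ∑ k ∈ Finset.Ico l r, A.dW (k - l) (c k)}
  zero_mem' := ⟨0, fun _ _ => Submodule.zero_mem _, by simp, fun _ _ _ => by simp⟩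
  add_mem' := by
    rintro x y ⟨c, h1, rfl, h3⟩ ⟨c', h1', rfl, h3'⟩
    refine ⟨c + c', fun k hk => Submodule.add_mem _ (h1 k hk) (h1' k hk),
      by simp [Finset.sum_add_distrib], fun l a b => ?_⟩
    simp [Finset.sum_add_distrib, ← h3 l a b, ← h3' l a b]
  smul_mem' := by
    rintro t x ⟨c, h1, rfl, h3⟩
    refine ⟨t • c, fun k hk => Submodule.smul_mem _ t (h1 k hk),
      by simp [Finset.smul_sum], fun l a b => ?_⟩
    simp [← Finset.smul_sum, ← h3 l a b]

/-- The term `E_r^{p,*}` of the spectral sequence of the filtration by weights. -/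
abbrev specPage (r : ℕ) (p : ℤ) : Type _ := Page (d E G) A.filtration r p

/-- The quotient `Z_r^{p,*} / B_r^{p,*}`. -/
abbrev ZB (r : ℕ) (p : ℤ) : Type _ := ↥(A.Z r p) ⧸ (A.B r p).submoduleOf (A.Z r p)

/-- The differential of the `r`-th page of the spectral sequence of the filtration by weights. -/
def specDiff (r : ℕ) (p : ℤ) : A.specPage r p →ₗ[ℝ] A.specPage r (p + r) :=
  pageDiff (d E G) d_d A.filtration r p

/-- The differential of the `r`-th page, read in the quotients `Z_r / B_r` through isomorphisms
`ψ : E_r ≅ Z_r / B_r`. -/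
def partialD (r : ℕ) (ψ : ∀ p : ℤ, A.specPage r p ≃ₗ[ℝ] A.ZB r p) (p : ℤ) :
    A.ZB r p →ₗ[ℝ] A.ZB r (p + r) :=
  (ψ (p + r)).toLinearMap ∘ₗ A.specDiff r p ∘ₗ (ψ p).symm.toLinearMap

end AdaptedBasis

end TotalComplex

end Carnot

end

/-!
The part `d_0` of `d` acts pointwise, and `N = d_0⁻¹ (d - d_0)` raises the weight, so it is
nilpotent and `P = (1 + N)⁻¹`. A form `Y` with `d_0⁻¹ Y = 0` and `d_0⁻¹ d Y = 0`, such as `Π_E X` or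
`d Π_E X`, satisfies `(1 + N) Y = Π_{E_0} Y`, that is `Y = P Π_{E_0} Y`. Since `Π_E = P` on `E_0`,
this gives `P d_c = d P` on `E_0`.

For a form `α` of weight `p`, expanding `P α = α - N P α` by weights shows that `-ζ_j α` is the
component of `P α` of weight `p + j`, so the component of `d P α` of weight `p + r` is
`D_r α - d_0 ζ_r α`. If `α ∈ E_0`, applying `Π_{E_0}`, which kills the image of `d_0`, gives the
component `Π_{E_0} D_r α` of `d_c α`.

In the spectral sequence, `(x)_p` belongs to `Z_r` for every cycle `x`, the `z_{p+j}` being the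
negatives of the next components of `x`; conversely `x - ∑ z_{p+j}` is a cycle with leading
component `x`. As `P` does not change the leading component, `P y` is a cycle lifting `(y)_p` when
`y ∈ E_0` and `d_c y` has weight at least `p + r`, and `d P y = P d_c y` computes `∂_r [(y)_p]`. All
classes arise in this way, because `Π_E` is homotopic to the identity by the homotopy `P d_0⁻¹`,
which preserves the filtration.
-/

noncomputable section
namespace Carnot

section CompositionSums
variable {𝕜 R : Type*} [CommRing 𝕜] [Ring R] [Algebra 𝕜 R]

/-- The sum of the products `f i₁ * ⋯ * f iₘ` over the compositions `i₁ + ⋯ + iₘ = j` of `j` into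
`m` positive parts. -/
def compositionSum {R : Type*} [Semiring R] (f : ℕ → R) (m j : ℕ) : R :=
  ∑ I ∈ (Finset.Nat.antidiagonalTuple m j).filter (fun I => ∀ k, 1 ≤ I k),
    (List.ofFn fun k => f (I k)).prod

/-- The sum over all compositions of `j ≥ 1`, a composition into `m` parts having sign
`(-1) ^ (m - 1)`. For `j ≥ 1` these are, up to sign, the coefficients of the inverse of the power
series `1 + f 1 X + f 2 X² + ⋯`. -/
def altCompositionSum (𝕜 : Type*) {R : Type*} [CommRing 𝕜] [Ring R] [Algebra 𝕜 R] (f : ℕ → R)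
    (j : ℕ) : R :=
  ∑ m ∈ Finset.Icc 1 j, (-1 : 𝕜) ^ (m - 1) • compositionSum f m j

theorem compositionSum_one {R : Type*} [Semiring R] (f : ℕ → R) {j : ℕ} (hj : 1 ≤ j) :
    compositionSum f 1 j = f j := by
  rw [compositionSum, Finset.Nat.antidiagonalTuple_one, Finset.filter_true_of_mem] <;> simp [hj]

theorem compositionSum_succ {R : Type*} [Semiring R] (f : ℕ → R) (m j : ℕ) :
    compositionSum f (m + 1) j = ∑ i ∈ Finset.Icc 1 j, f i * compositionSum f m (j - i) := by
  simp only [compositionSum, Finset.mul_sum]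
  rw [Finset.sum_sigma']
  refine Finset.sum_bij' (fun I _ => ⟨I 0, Fin.tail I⟩)
    (fun s _ => (Fin.cons s.1 s.2 : Fin (m + 1) → ℕ)) ?_ ?_ ?_ ?_ ?_
  · intro I hI
    simp only [Finset.mem_sigma, Finset.mem_filter, Finset.Nat.mem_antidiagonalTuple,
      Finset.mem_Icc, Fin.sum_univ_succ, Fin.tail] at hI ⊢
    exact ⟨⟨hI.2 0, by omega⟩, by omega, fun k => hI.2 k.succ⟩
  · rintro ⟨i, I⟩ hs
    simp only [Finset.mem_sigma, Finset.mem_filter, Finset.Nat.mem_antidiagonalTuple,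
      Finset.mem_Icc, Fin.sum_univ_succ, Fin.cons_zero, Fin.cons_succ, Fin.forall_fin_succ]
      at hs ⊢
    exact ⟨by omega, hs.1.1, hs.2.2⟩
  all_goals simp [List.ofFn_succ, Fin.tail]

theorem compositionSum_of_lt {R : Type*} [Semiring R] (f : ℕ → R) {m j : ℕ} (h : j < m) :
    compositionSum f m j = 0 := by
  refine Finset.sum_eq_zero fun I hI => ?_
  rw [Finset.mem_filter, Finset.Nat.mem_antidiagonalTuple] at hI
  have hm : m ≤ ∑ k, I k := by
    simpa using Finset.card_nsmul_le_sum Finset.univ I 1 fun k _ => hI.2 k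
  omega

theorem altCompositionSum_eq_sum_range (f : ℕ → R) {N j : ℕ} (h : j ≤ N) :
    altCompositionSum 𝕜 f j =
      ∑ m ∈ Finset.range N, (-1 : 𝕜) ^ m • compositionSum f (m + 1) j := by
  rw [altCompositionSum, ← Finset.Ico_add_one_right_eq_Icc, Finset.sum_Ico_eq_sum_range,
    Nat.add_sub_cancel]
  simp only [Nat.add_comm 1, Nat.add_sub_cancel]
  refine Finset.sum_subset (Finset.range_subset_range.2 h) fun m _ hm => ?_
  rw [Finset.mem_range, not_lt] at hm
  rw [compositionSum_of_lt f (by omega), smul_zero]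

theorem altCompositionSum_eq_sub (f : ℕ → R) {j : ℕ} (hj : 1 ≤ j) :
    altCompositionSum 𝕜 f j =
      f j - ∑ i ∈ Finset.Ico 1 j, f i * altCompositionSum 𝕜 f (j - i) := by
  have tail (m : ℕ) : (-1 : 𝕜) ^ (m + 1) • compositionSum f (m + 1 + 1) j =
      -∑ i ∈ Finset.Ico 1 j, f i * ((-1 : 𝕜) ^ m • compositionSum f (m + 1) (j - i)) := by
    rw [compositionSum_succ, ← Finset.Ico_insert_right hj,
      Finset.sum_insert Finset.right_notMem_Ico, Nat.sub_self,
      compositionSum_of_lt f (Nat.succ_pos m), mul_zero, zero_add, pow_succ, mul_neg_one, neg_smul,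
      Finset.smul_sum]
    simp only [mul_smul_comm]
  rw [altCompositionSum_eq_sum_range f (Nat.le_succ j), Finset.sum_range_succ', pow_zero, one_smul,
    compositionSum_one f hj, add_comm, sub_eq_add_neg]
  simp only [tail]
  rw [Finset.sum_neg_distrib, Finset.sum_comm]
  congr 2
  refine Finset.sum_congr rfl fun i _ => ?_
  rw [altCompositionSum_eq_sum_range f (Nat.sub_le j i), Finset.mul_sum]

end CompositionSums

section ShiftingEndomorphisms
variable {R M : Type*} [CommRing R] [AddCommGroup M] [Module R M] {F : ℤ → Submodule R M}

/-- The endomorphisms of degree `k` with respect to a family `F` of submodules: those that map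
`F p` into `F (p + k)` for every `p`. It is used for gradings as well as for filtrations. -/
def shiftEnd (F : ℤ → Submodule R M) (k : ℤ) : Submodule R (Module.End R M) where
  carrier := {T | ∀ p, ∀ x ∈ F p, T x ∈ F (p + k)}
  zero_mem' p _ _ := (F (p + k)).zero_mem
  add_mem' hS hT p x hx := (F (p + k)).add_mem (hS p x hx) (hT p x hx)
  smul_mem' c _ hT p x hx := (F (p + k)).smul_mem c (hT p x hx)

theorem apply_mem_of_mem_shiftEnd {k p q : ℤ} {T : Module.End R M} (hT : T ∈ shiftEnd F k)
    (h : p + k = q) {x : M} (hx : x ∈ F p) : T x ∈ F q :=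
  h ▸ hT p x hx

theorem one_mem_shiftEnd : 1 ∈ shiftEnd F 0 := fun p x hx => by
  rwa [add_zero]

theorem mul_mem_shiftEnd {k l m : ℤ} {S T : Module.End R M} (hS : S ∈ shiftEnd F k)
    (hT : T ∈ shiftEnd F l) (h : k + l = m) : S * T ∈ shiftEnd F m := fun p x hx =>
  apply_mem_of_mem_shiftEnd hS (by omega) (hT p x hx)

theorem pow_mem_shiftEnd {k : ℤ} {T : Module.End R M} (hT : T ∈ shiftEnd F k) (m : ℕ) :
    T ^ m ∈ shiftEnd F (m * k) := by
  induction m with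
  | zero => simpa using one_mem_shiftEnd
  | succ m ih => exact pow_succ T m ▸ mul_mem_shiftEnd ih hT (by push_cast; ring)

theorem shiftEnd_antitone (hF : Antitone F) : Antitone (shiftEnd F) := fun _ _ hkl _ hT p x hx =>
  hF (by omega) (hT p x hx)

end ShiftingEndomorphisms

section HomotopyPerturbation
variable {R : Type*} [Ring R]

/-- The data of the perturbation argument: a differential `d`, a differential `d₀` of which `d` is a
perturbation, a partial inverse `δ` of `d₀`, and an inverse `P` of `1 + δ (d - d₀)`. -/
structure HomotopyPerturbation (d d₀ δ P : R) : Prop where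
  d_mul_d : d * d = 0
  d₀_mul_d₀ : d₀ * d₀ = 0
  δ_mul_δ : δ * δ = 0
  d₀_mul_δ_mul_d₀ : d₀ * δ * d₀ = d₀
  δ_mul_d₀_mul_δ : δ * d₀ * δ = δ
  one_add_mul_P : (1 + δ * (d - d₀)) * P = 1
  P_mul_one_add : P * (1 + δ * (d - d₀)) = 1

namespace HomotopyPerturbation
variable {d d₀ δ P : R} (h : HomotopyPerturbation d d₀ δ P)
include h

theorem d₀_mul_projE0 : d₀ * (1 - d₀ * δ - δ * d₀) = 0 := by
  rw [mul_sub, mul_sub, ← mul_assoc d₀ d₀, ← mul_assoc d₀ δ, h.d₀_mul_d₀, h.d₀_mul_δ_mul_d₀]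
  simp

theorem δ_mul_projE0 : δ * (1 - d₀ * δ - δ * d₀) = 0 := by
  rw [mul_sub, mul_sub, ← mul_assoc δ d₀, ← mul_assoc δ δ, h.δ_mul_δ, h.δ_mul_d₀_mul_δ]
  simp

theorem projE0_mul_d₀ : (1 - d₀ * δ - δ * d₀) * d₀ = 0 := by
  rw [sub_mul, sub_mul, mul_assoc δ d₀, h.d₀_mul_d₀, h.d₀_mul_δ_mul_d₀]
  simp

theorem P_mul_δ_eq : P * δ = δ * (1 - (d - d₀) * (P * δ)) := by
  have := congrArg (· * δ) h.one_add_mul_P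
  simp only [add_mul, one_mul] at this
  rw [mul_sub, mul_one, ← mul_assoc, ← mul_assoc]
  exact eq_sub_of_add_eq this

theorem δ_mul_P_mul_δ : δ * (P * δ) = 0 := by
  rw [h.P_mul_δ_eq, ← mul_assoc, h.δ_mul_δ, zero_mul]

theorem δ_mul_d₀_mul_P_mul_δ : δ * d₀ * (P * δ) = P * δ := by
  rw [h.P_mul_δ_eq, ← mul_assoc, h.δ_mul_d₀_mul_δ]

theorem δ_mul_d_mul_P_mul_δ : δ * d * (P * δ) = δ :=
  calc δ * d * (P * δ) = δ * d₀ * (P * δ) + δ * (d - d₀) * (P * δ) := by noncomm_ring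
    _ = (1 + δ * (d - d₀)) * P * δ := by rw [h.δ_mul_d₀_mul_P_mul_δ]; noncomm_ring
    _ = δ := by rw [h.one_add_mul_P, one_mul]

theorem δ_mul_projE : δ * (1 - d * P * δ - P * δ * d) = 0 :=
  calc δ * (1 - d * P * δ - P * δ * d) = δ - δ * d * (P * δ) - δ * (P * δ) * d := by noncomm_ring
    _ = 0 := by rw [h.δ_mul_d_mul_P_mul_δ, h.δ_mul_P_mul_δ, zero_mul, sub_self, sub_zero]

theorem d_mul_projE : d * (1 - d * P * δ - P * δ * d) = d - d * (P * δ) * d :=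
  calc d * (1 - d * P * δ - P * δ * d) = d - d * d * (P * δ) - d * (P * δ) * d := by noncomm_ring
    _ = d - d * (P * δ) * d := by rw [h.d_mul_d, zero_mul, sub_zero]

theorem δ_mul_d_mul_projE : δ * d * (1 - d * P * δ - P * δ * d) = 0 :=
  calc δ * d * (1 - d * P * δ - P * δ * d) = δ * d - δ * d * (P * δ) * d := by
        rw [mul_assoc, h.d_mul_projE]; noncomm_ring
    _ = 0 := by rw [h.δ_mul_d_mul_P_mul_δ, sub_self]

theorem P_mul_projE0_mul {y : R} (hy : δ * y = 0) (hdy : δ * d * y = 0) :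
    P * (1 - d₀ * δ - δ * d₀) * y = y :=
  calc P * (1 - d₀ * δ - δ * d₀) * y
      = P * (1 + δ * (d - d₀)) * y - P * d₀ * (δ * y) - P * (δ * d * y) := by noncomm_ring
    _ = y := by rw [h.P_mul_one_add, hy, hdy, mul_zero, mul_zero, sub_zero, sub_zero, one_mul]

theorem projE_eq : 1 - d * P * δ - P * δ * d = P - d * P * δ - P * δ * d₀ :=
  calc 1 - d * P * δ - P * δ * d
      = P * (1 + δ * (d - d₀)) - d * P * δ - P * δ * d := by rw [h.P_mul_one_add]
    _ = P - d * P * δ - P * δ * d₀ := by noncomm_ring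

theorem P_mul_projE0_mul_projE :
    P * (1 - d₀ * δ - δ * d₀) * (1 - d * P * δ - P * δ * d) = 1 - d * P * δ - P * δ * d :=
  h.P_mul_projE0_mul h.δ_mul_projE h.δ_mul_d_mul_projE

theorem P_mul_projE0_mul_d_mul_projE :
    P * ((1 - d₀ * δ - δ * d₀) * d * (1 - d * P * δ - P * δ * d)) =
      d * (1 - d * P * δ - P * δ * d) := by
  have hδd : δ * d * (d * (1 - d * P * δ - P * δ * d)) = 0 := by
    rw [← mul_assoc, mul_assoc δ d d, h.d_mul_d, mul_zero, zero_mul]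
  rw [mul_assoc, ← mul_assoc P]
  exact h.P_mul_projE0_mul (by rw [← mul_assoc, h.δ_mul_d_mul_projE]) hδd

end HomotopyPerturbation

theorem one_add_mul_sum_neg_one_pow_smul {𝕜 : Type*} [CommRing 𝕜] [Algebra 𝕜 R] {x : R} {m : ℕ}
    (hx : x ^ m = 0) : (1 + x) * ∑ k ∈ Finset.range m, (-1 : 𝕜) ^ k • x ^ k = 1 := by
  have hgeom := mul_neg_geom_sum (-x) m
  rw [sub_neg_eq_add, neg_pow, hx, mul_zero, sub_zero] at hgeom
  simpa only [← smul_pow, neg_one_smul] using hgeom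

theorem sum_neg_one_pow_smul_mul_one_add {𝕜 : Type*} [CommRing 𝕜] [Algebra 𝕜 R] {x : R} {m : ℕ}
    (hx : x ^ m = 0) : (∑ k ∈ Finset.range m, (-1 : 𝕜) ^ k • x ^ k) * (1 + x) = 1 := by
  have hgeom := geom_sum_mul_neg (-x) m
  rw [sub_neg_eq_add, neg_pow, hx, mul_zero, sub_zero] at hgeom
  simpa only [← smul_pow, neg_one_smul] using hgeom

end HomotopyPerturbation

section FilteredComplexes
variable {M : Type*} [AddCommGroup M] [Module ℝ M]

theorem cls_congr {Z B : Submodule ℝ M} {x y : M} {hx : x ∈ Z} {hy : y ∈ Z} (h : x = y) :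
    cls Z B x hx = cls Z B y hy := by
  subst h
  rfl

theorem cls_eq_iff {Z B : Submodule ℝ M} {x y : M} {hx : x ∈ Z} {hy : y ∈ Z} :
    cls Z B x hx = cls Z B y hy ↔ x - y ∈ B :=
  Submodule.Quotient.eq _

variable {d : Module.End ℝ M} {F : ℤ → Submodule ℝ M}

theorem mem_cycles {r : ℕ} {p : ℤ} {x : M} :
    x ∈ cycles d F r p ↔ x ∈ F p ∧ d x ∈ F (p + r) := Iff.rfl

theorem boundaries_succ_le_cycles (hd : ∀ x, d (d x) = 0) (hF : Antitone F) (r : ℕ) (p : ℤ) :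
    boundaries d F (r + 1) p ≤ cycles d F (r + 1) p := by
  refine sup_le (fun x hx => ⟨hF (by omega) hx.1, hF (by push_cast; omega) hx.2⟩) ?_
  rintro _ ⟨c, hc, rfl⟩
  refine mem_cycles.2 ⟨hF (by omega) hc.2, ?_⟩
  rw [hd]
  exact Submodule.zero_mem _

theorem homotopy_mem_boundaries_succ {K : Module.End ℝ M} (hF : Antitone F)
    (hd : d ∈ shiftEnd F 0) (hK : K ∈ shiftEnd F 0) {r : ℕ} {p : ℤ} {x : M}
    (hx : x ∈ cycles d F (r + 1) p) : d (K x) + K (d x) ∈ boundaries d F (r + 1) p := by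
  have hKx : K x ∈ F p := apply_mem_of_mem_shiftEnd hK (add_zero p) hx.1
  have hKdx : K (d x) ∈ F (p + (r + 1 : ℕ)) := apply_mem_of_mem_shiftEnd hK (add_zero _) hx.2
  have h1 : K (d x) ∈ cycles d F r (p + 1) :=
    ⟨hF (by omega) hKdx, hF (by omega) (apply_mem_of_mem_shiftEnd hd (add_zero _) hKdx)⟩
  have h2 : K x ∈ cycles d F r (p - r) :=
    ⟨hF (by omega) hKx, hF (by omega) (apply_mem_of_mem_shiftEnd hd (add_zero _) hKx)⟩
  have h3 : d (K x) ∈ (cycles d F r (p - r)).map d := ⟨K x, h2, rfl⟩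
  exact add_comm (K (d x)) _ ▸ Submodule.add_mem_sup h1 h3

end FilteredComplexes

section MaurerCartan
open VectorField

variable {E : Type*} [NormedAddCommGroup E] [NormedSpace ℝ E]
  {G : Type*} [TopologicalSpace G] [ChartedSpace E G] [Group G]

variable (G) in
/-- The Lie bracket of the Lie algebra of `G`, on the model space. -/
def modelBracket (v w : E) : E :=
  Bracket.bracket (L := GroupLieAlgebra 𝓘(ℝ, E) G) (M := GroupLieAlgebra 𝓘(ℝ, E) G) v w

variable (G) in
/-- The Chevalley–Eilenberg differential of a covector. -/
def lieTerm : ∀ {h : ℕ}, Covec E h → (Fin (h + 1) → E) → ℝ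
  | 0, _, _ => 0
  | h + 1, ξ, v => -∑ i : Fin (h + 1), ∑ j ≥ i, (-1) ^ (i + j : ℕ) •
      ξ (Matrix.vecCons (modelBracket G (v i.castSucc) (v j.succ))
        (j.removeNth <| i.castSucc.removeNth v))

/-- The left-invariant vector field with value `v` at `1`, read in the chart at `x`. -/
def chartFrame (x : G) (v y : E) : E :=
  leftFrame x ((extChartAt 𝓘(ℝ, E) x).symm y) v

theorem chartFrame_extChartAt (x : G) (v : E) :
    chartFrame x v (extChartAt 𝓘(ℝ, E) x x) = leftFrame x x v := by
  rw [chartFrame, extChartAt_to_inv]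

theorem dFun_apply_chartFrame {h : ℕ} (α : G → Covec E h) (x : G) (v : Fin (h + 1) → E) :
    dFun α x v = extDeriv (chartForm α x) (extChartAt 𝓘(ℝ, E) x x)
      fun i => chartFrame x (v i) (extChartAt 𝓘(ℝ, E) x x) := by
  simp only [chartFrame_extChartAt]
  rfl

variable [LieGroup 𝓘(ℝ, E) ∞ G]

theorem leftFrame_apply {x₀ x : G} (hx : x ∈ (extChartAt 𝓘(ℝ, E) x₀).source) (v : E) :
    leftFrame x₀ x v = mfderiv 𝓘(ℝ, E) 𝓘(ℝ, E) (extChartAt 𝓘(ℝ, E) x₀) x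
      (mulInvariantVectorField (I := 𝓘(ℝ, E)) (v : GroupLieAlgebra 𝓘(ℝ, E) G) x) := by
  have hchart : MDifferentiableAt 𝓘(ℝ, E) 𝓘(ℝ, E) (extChartAt 𝓘(ℝ, E) x₀) (x * 1) :=
    (contMDiffAt_extChartAt' (n := ∞) (by simpa using hx)).mdifferentiableAt (by simp)
  have hmul : MDifferentiableAt 𝓘(ℝ, E) 𝓘(ℝ, E) (fun k : G => x * k) 1 :=
    (contMDiff_mul_left (I := 𝓘(ℝ, E)) (n := ∞) (a := x)).contMDiffAt.mdifferentiableAt (by simp)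
  refine (congrArg (fun L => L v) (mfderiv_comp (1 : G) hchart hmul)).trans ?_
  change mfderiv 𝓘(ℝ, E) 𝓘(ℝ, E) (extChartAt 𝓘(ℝ, E) x₀) (x * 1) _ = _
  rw [mul_one]
  rfl

theorem contDiffAt_chartFrame (x : G) (v : E) :
    ContDiffAt ℝ ∞ (chartFrame x v) (extChartAt 𝓘(ℝ, E) x x) :=
  ((contDiffOn_leftFrame x).contDiffAt ((isOpen_extChartAt_target x).mem_nhds
    (mem_extChartAt_target x))).clm_apply contDiffAt_const

theorem mpullbackWithin_mulInvariantVectorField_eventuallyEq [CompleteSpace E] (x : G) (v : E) :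
    (mpullbackWithin 𝓘(ℝ, E) 𝓘(ℝ, E) (extChartAt 𝓘(ℝ, E) x).symm
      (mulInvariantVectorField (I := 𝓘(ℝ, E)) (v : GroupLieAlgebra 𝓘(ℝ, E) G))
      (Set.range 𝓘(ℝ, E)) : E → E) =ᶠ[𝓝 (extChartAt 𝓘(ℝ, E) x x)] chartFrame x v := by
  filter_upwards [(isOpen_extChartAt_target (I := 𝓘(ℝ, E)) x).mem_nhds
    (mem_extChartAt_target x)] with y hy
  rw [chartFrame, leftFrame_apply ((extChartAt 𝓘(ℝ, E) x).map_target hy)]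
  have hinv := ContinuousLinearMap.inverse_eq
    (mfderivWithin_extChartAt_symm_comp_mfderiv_extChartAt (I := 𝓘(ℝ, E)) hy)
    (mfderiv_extChartAt_comp_mfderivWithin_extChartAt_symm (I := 𝓘(ℝ, E)) hy)
  exact congrArg (fun L => L (mulInvariantVectorField (I := 𝓘(ℝ, E))
    (v : GroupLieAlgebra 𝓘(ℝ, E) G) ((extChartAt 𝓘(ℝ, E) x).symm y))) hinv

theorem lieBracket_chartFrame [CompleteSpace E] (x : G) (v w : E) :
    lieBracket ℝ (chartFrame x v) (chartFrame x w) (extChartAt 𝓘(ℝ, E) x x) =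
      leftFrame x x (modelBracket G v w) := by
  have : LieGroup 𝓘(ℝ, E) (minSmoothness ℝ 3) G :=
    LieGroup.of_le (m := minSmoothness ℝ 3) (n := ∞) (by simpa using ENat.LEInfty.out)
  have hx := mem_extChartAt_source (I := 𝓘(ℝ, E)) x
  have hpull (u : E) := mpullbackWithin_mulInvariantVectorField_eventuallyEq x u
  refine (Filter.EventuallyEq.lieBracket_vectorField_eq (𝕜 := ℝ) (hpull v).symm
    (hpull w).symm).trans ?_
  rw [leftFrame_apply hx]
  change _ = mfderiv 𝓘(ℝ, E) 𝓘(ℝ, E) (extChartAt 𝓘(ℝ, E) x) x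
    (mulInvariantVectorField (I := 𝓘(ℝ, E)) (mlieBracket 𝓘(ℝ, E)
    (mulInvariantVectorField (I := 𝓘(ℝ, E)) (v : GroupLieAlgebra 𝓘(ℝ, E) G))
    (mulInvariantVectorField (I := 𝓘(ℝ, E)) (w : GroupLieAlgebra 𝓘(ℝ, E) G)) 1) x)
  rw [congrFun (mulInvariantVector_mlieBracket (I := 𝓘(ℝ, E)) (G := G) v w) x,
    ← mlieBracketWithin_univ, mlieBracketWithin_apply]
  refine Eq.trans ?_ ((isInvertible_mfderiv_extChartAt hx).self_apply_inverse _).symm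
  simp only [modelWithCornersSelf_coe, Set.range_id, Set.preimage_univ, Set.inter_univ]
  exact (congrFun (lieBracketWithin_univ (𝕜 := ℝ) (E := E)) _).symm

theorem chartForm_chartFrame {h : ℕ} (α : G → Covec E h) (x : G) {y : E}
    (hy : y ∈ (extChartAt 𝓘(ℝ, E) x).target) (v : Fin h → E) :
    chartForm α x y (fun i => chartFrame x (v i) y) = α ((extChartAt 𝓘(ℝ, E) x).symm y) v := by
  have hinv := leftFrame_isInvertible (E := E) x ((extChartAt 𝓘(ℝ, E) x).symm y)
    ((extChartAt 𝓘(ℝ, E) x).map_target hy)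
  simp only [chartForm, chartFrame, ContinuousAlternatingMap.compContinuousLinearMap_apply,
    Function.comp_def, hinv.inverse_apply_self]

theorem fderiv_chartForm_chartFrame {h : ℕ} (α : G → Covec E h) (x : G) (v : Fin h → E) :
    fderiv ℝ (fun y => chartForm α x y (fun i => chartFrame x (v i) y)) (extChartAt 𝓘(ℝ, E) x x) =
      fderiv ℝ (fun y => α ((extChartAt 𝓘(ℝ, E) x).symm y) v) (extChartAt 𝓘(ℝ, E) x x) := by
  apply Filter.EventuallyEq.fderiv_eq
  filter_upwards [(isOpen_extChartAt_target (I := 𝓘(ℝ, E)) x).mem_nhds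
    (mem_extChartAt_target x)] with y hy
  exact chartForm_chartFrame α x hy v

theorem chartForm_lieBracket_chartFrame [CompleteSpace E] {h : ℕ} (α : G → Covec E (h + 1))
    (x : G) (v w : E) (u : Fin h → E) :
    chartForm α x (extChartAt 𝓘(ℝ, E) x x)
      (Matrix.vecCons (lieBracket ℝ (chartFrame x v) (chartFrame x w) (extChartAt 𝓘(ℝ, E) x x))
        fun k => chartFrame x (u k) (extChartAt 𝓘(ℝ, E) x x)) =
      α x (Matrix.vecCons (modelBracket G v w) u) := by
  have hform := chartForm_chartFrame α x (mem_extChartAt_target x)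
    (Matrix.vecCons (modelBracket G v w) u)
  rw [extChartAt_to_inv] at hform
  rw [← hform, lieBracket_chartFrame]
  congr 1
  funext k
  refine Fin.cases (chartFrame_extChartAt x _).symm (fun k => ?_) k
  simp only [Matrix.cons_val_succ]

variable [FiniteDimensional ℝ E]

theorem dFun_apply {h : ℕ} (α : Form E G h) (x : G) (v : Fin (h + 1) → E) :
    dFun α x v = (∑ i, (-1) ^ i.val • fderiv ℝ
      (fun y => α ((extChartAt 𝓘(ℝ, E) x).symm y) (i.removeNth v))
        (extChartAt 𝓘(ℝ, E) x x) (leftFrame x x (v i))) + lieTerm G (α x) v := by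
  have := FiniteDimensional.complete ℝ E
  have hα := (contDiffAt_chartForm α x (mem_extChartAt_target x)).differentiableAt (by simp)
  have hframe (i : Fin (h + 1)) :
      DifferentiableAt ℝ (chartFrame x (v i)) (extChartAt 𝓘(ℝ, E) x x) :=
    (contDiffAt_chartFrame x (v i)).differentiableAt (by simp)
  simp only [dFun_apply_chartFrame, ← fderiv_chartForm_chartFrame, ← chartFrame_extChartAt]
  cases h with
  | zero =>
    rw [extDeriv_apply hα, lieTerm, add_zero]
    refine Finset.sum_congr rfl fun i _ => ?_
    congr! 4
    exact congrArg _ (Subsingleton.elim _ _)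
  | succ h =>
    rw [extDeriv_apply_vectorField hα hframe, sub_eq_add_neg]
    congr 1
    rw [lieTerm]
    congr 1
    refine Finset.sum_congr rfl fun i _ => Finset.sum_congr rfl fun j _ => congrArg _ ?_
    exact chartForm_lieBracket_chartFrame α x _ _ _

theorem covD0_apply {h : ℕ} (ξ : Covec E h) (v : Fin (h + 1) → E) :
    covD0 E G h ξ v = lieTerm G ξ v := by
  refine (dFun_apply ⟨fun _ => ξ, contMDiff_const⟩ (1 : G) v).trans ?_
  refine add_eq_right.2 (Finset.sum_eq_zero fun i _ => ?_)
  change (-1) ^ i.val • fderiv ℝ (fun _ : E => ξ (i.removeNth v)) _ _ = 0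
  rw [fderiv_const_apply, zero_apply, smul_zero]

theorem deRham_apply {h : ℕ} (α : Form E G h) (x : G) (v : Fin (h + 1) → E) :
    deRham (E := E) (G := G) h α x v = (∑ i, (-1) ^ i.val • fderiv ℝ
      (fun y => α ((extChartAt 𝓘(ℝ, E) x).symm y) (i.removeNth v))
        (extChartAt 𝓘(ℝ, E) x x) (leftFrame x x (v i))) + covD0 E G h (α x) v := by
  rw [covD0_apply]
  exact dFun_apply α x v

end MaurerCartan

section CovectorWeights
variable {E : Type*} [NormedAddCommGroup E] [NormedSpace ℝ E] {n : ℕ}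

theorem mem_incr {h n : ℕ} {J : Fin h → Fin n} : J ∈ incr h n ↔ StrictMono J := by
  simp [incr]

theorem eq_of_incr (b : Module.Basis (Fin n) ℝ E) {h : ℕ} {ξ η : Covec E h}
    (H : ∀ J ∈ incr h n, ξ (fun i => b (J i)) = η (fun i => b (J i))) : ξ = η :=
  sub_eq_zero.1 (eq_zero_of_incr b _ fun J hJ => sub_eq_zero.2 (H J hJ))

theorem apply_basis_eq_zero (b : Module.Basis (Fin n) ℝ E) (w : Fin n → ℕ) {h : ℕ}
    {ξ : Covec E h} {t : ℤ}
    (hξ : ∀ J ∈ incr h n, ∑ i, (w (J i) : ℤ) = t → ξ (fun i => b (J i)) = 0)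
    (J : Fin h → Fin n) (ht : ∑ i, (w (J i) : ℤ) = t) : ξ (fun i => b (J i)) = 0 := by
  by_cases hJ : Function.Injective J
  · have hmono : StrictMono (J ∘ Tuple.sort J) :=
      (Tuple.monotone_sort J).strictMono_of_injective (hJ.comp (Tuple.sort J).injective)
    have hsorted : ξ ((fun i => b (J i)) ∘ Tuple.sort J) = 0 :=
      hξ (J ∘ Tuple.sort J) (mem_incr.2 hmono)
        ((Equiv.sum_comp (Tuple.sort J) fun i => (w (J i) : ℤ)).trans ht)
    exact (smul_eq_zero_iff_eq _).1
      ((ξ.toAlternatingMap.map_perm (fun i => b (J i)) (Tuple.sort J)).symm.trans hsorted)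
  · obtain ⟨i, j, hij, hne⟩ := Function.not_injective_iff.1 hJ
    exact ξ.map_eq_zero_of_eq _ (congrArg b hij) hne

theorem covInner_apply (b : Module.Basis (Fin n) ℝ E) {h : ℕ} (ξ η : Covec E h) :
    covInner b h ξ η = ∑ J ∈ incr h n, ξ (fun i => b (J i)) * η (fun i => b (J i)) := rfl

theorem eq_zero_of_covInner_self (b : Module.Basis (Fin n) ℝ E) {h : ℕ} {ξ : Covec E h}
    (hξ : covInner b h ξ ξ = 0) : ξ = 0 := by
  rw [covInner_apply, Finset.sum_eq_zero_iff_of_nonneg fun _ _ => mul_self_nonneg _] at hξ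
  exact eq_zero_of_incr b ξ fun J hJ => mul_self_eq_zero.1 (hξ J hJ)

theorem covInner_comm (b : Module.Basis (Fin n) ℝ E) {h : ℕ} (ξ η : Covec E h) :
    covInner b h ξ η = covInner b h η ξ := by
  simp only [covInner_apply, mul_comm]

theorem sum_weight_le (w : Fin n → ℕ) {h : ℕ} {K : Fin h → Fin n} (hK : K ∈ incr h n) :
    ∑ i, w (K i) ≤ ∑ i, w i := by
  rw [← Finset.sum_image (s := Finset.univ) (g := K) (f := w) (mem_incr.1 hK).injective.injOn]
  exact Finset.sum_le_sum_of_subset (Finset.subset_univ _)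

variable [FiniteDimensional ℝ E]

theorem wedge_apply (b : Module.Basis (Fin n) ℝ E) {h : ℕ} (J K : Fin h → Fin n) :
    wedge b J (fun i => b (K i)) =
      Matrix.det (Matrix.of fun i j => if K i = J j then (1 : ℝ) else 0) := by
  change Matrix.det (Matrix.of fun i j => b.coord (J j) (b (K i))) = _
  simp only [Module.Basis.coord_apply, Module.Basis.repr_self, Finsupp.single_apply]

theorem wedge_apply_incr (b : Module.Basis (Fin n) ℝ E) {h : ℕ} {J K : Fin h → Fin n}
    (hJ : J ∈ incr h n) (hK : K ∈ incr h n) :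
    wedge b J (fun i => b (K i)) = if J = K then 1 else 0 := by
  rw [mem_incr] at hJ hK
  rw [wedge_apply]
  split_ifs with hJK
  · subst hJK
    rw [← Matrix.det_one (n := Fin h)]
    congr 1
    ext i j
    simp [Matrix.one_apply, hJ.injective.eq_iff]
  · obtain ⟨i, hi⟩ : ∃ i, ∀ j, K i ≠ J j := by
      by_contra! hKJ
      have hsub : Set.range K ⊆ Set.range J :=
        Set.range_subset_iff.2 fun i => (hKJ i).imp fun _ => Eq.symm
      refine hJK ((hJ.range_inj hK).1 (Set.eq_of_subset_of_ncard_le hsub ?_).symm)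
      rw [Set.ncard_range_of_injective hJ.injective, Set.ncard_range_of_injective hK.injective]
    exact Matrix.det_eq_zero_of_row_eq_zero i fun j => if_neg (hi j)

theorem covProj_apply_incr (b : Module.Basis (Fin n) ℝ E) (w : Fin n → ℕ) {h : ℕ} (a : ℤ)
    (ξ : Covec E h) {K : Fin h → Fin n} (hK : K ∈ incr h n) :
    covProj b w h a ξ (fun i => b (K i)) =
      if ∑ i, (w (K i) : ℤ) = a then ξ (fun i => b (K i)) else 0 := by
  change (∑ J ∈ (incr h n).filter (fun J => ∑ i, (w (J i) : ℤ) = a),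
    ξ (fun i => b (J i)) • wedge b J) (fun i => b (K i)) = _
  rw [ContinuousAlternatingMap.sum_apply]
  have hterm : ∀ J ∈ (incr h n).filter (fun J => ∑ i, (w (J i) : ℤ) = a),
      (ξ (fun i => b (J i)) • wedge b J) (fun i => b (K i)) =
        if J = K then ξ (fun i => b (J i)) else 0 := fun J hJ => by
    rw [ContinuousAlternatingMap.smul_apply, wedge_apply_incr b (Finset.mem_filter.1 hJ).1 hK,
      smul_eq_mul, mul_ite, mul_one, mul_zero]
  rw [Finset.sum_congr rfl hterm, Finset.sum_ite_eq']
  simp only [Finset.mem_filter, hK, true_and]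

theorem covProj_apply (b : Module.Basis (Fin n) ℝ E) (w : Fin n → ℕ) {h : ℕ} (a : ℤ)
    (ξ : Covec E h) (K : Fin h → Fin n) :
    covProj b w h a ξ (fun i => b (K i)) =
      if ∑ i, (w (K i) : ℤ) = a then ξ (fun i => b (K i)) else 0 := by
  split_ifs with ha
  · refine sub_eq_zero.1 (apply_basis_eq_zero b w (ξ := covProj b w h a ξ - ξ)
      (fun J hJ hJa => ?_) K ha)
    rw [ContinuousAlternatingMap.sub_apply, covProj_apply_incr b w a ξ hJ, if_pos hJa, sub_self]
  · refine apply_basis_eq_zero b w (fun J hJ hJa => ?_) K rfl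
    rw [covProj_apply_incr b w a ξ hJ, hJa, if_neg ha]

theorem covProj_covProj (b : Module.Basis (Fin n) ℝ E) (w : Fin n → ℕ) {h : ℕ} (a c : ℤ)
    (ξ : Covec E h) :
    covProj b w h a (covProj b w h c ξ) = if a = c then covProj b w h a ξ else 0 := by
  refine eq_of_incr b fun K _ => ?_
  rcases eq_or_ne a c with rfl | hac
  · simp only [covProj_apply, if_true]
    split_ifs <;> rfl
  · simp only [covProj_apply, if_neg hac]
    split_ifs with ha hc
    · exact absurd (ha.symm.trans hc) hac
    · rfl
    · rfl

theorem covProj_eq_zero (b : Module.Basis (Fin n) ℝ E) (w : Fin n → ℕ) {h : ℕ} {a : ℤ}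
    (ha : a < 0 ∨ ((∑ i, w i : ℕ) : ℤ) < a) (ξ : Covec E h) : covProj b w h a ξ = 0 := by
  refine eq_zero_of_incr b _ fun K hK => ?_
  have hle := sum_weight_le w hK
  rw [covProj_apply, if_neg]
  rw [← Nat.cast_sum]
  omega

theorem sum_covProj (b : Module.Basis (Fin n) ℝ E) (w : Fin n → ℕ) {h : ℕ} (ξ : Covec E h) :
    ∑ a ∈ Finset.range ((∑ i, w i) + 1), covProj b w h a ξ = ξ := by
  refine eq_of_incr b fun K hK => ?_
  rw [ContinuousAlternatingMap.sum_apply]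
  simp only [covProj_apply, ← Nat.cast_sum, Nat.cast_inj]
  rw [Finset.sum_ite_eq, if_pos (Finset.mem_range_succ_iff.2 (sum_weight_le w hK))]

theorem covInner_covProj (b : Module.Basis (Fin n) ℝ E) (w : Fin n → ℕ) {h : ℕ} (a : ℤ)
    (ξ η : Covec E h) :
    covInner b h ξ (covProj b w h a η) = covInner b h (covProj b w h a ξ) η := by
  simp only [covInner_apply, covProj_apply, mul_ite, ite_mul, mul_zero, zero_mul]

end CovectorWeights

section PartialInverse
variable {E : Type*} [NormedAddCommGroup E] [NormedSpace ℝ E] [FiniteDimensional ℝ E] {n : ℕ}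
  (b : Module.Basis (Fin n) ℝ E) {h k : ℕ} (f : Covec E h →ₗ[ℝ] Covec E k)

theorem covInner_partialInverse (β : Covec E k) {κ : Covec E h} (hκ : f κ = 0) :
    covInner b h κ (partialInverse b f β) = 0 :=
  have hmem : partialInverse b f β ∈ (covInner b h).orthogonal (LinearMap.ker f) :=
    Subtype.property _
  hmem κ hκ

theorem map_partialInverse (β : Covec E k) :
    f (partialInverse b f β) =
      Submodule.projectionOnto _ _ (isCompl_orthogonal b k (LinearMap.range f)) β := by
  set ρ := Submodule.projectionOnto _ _ (isCompl_orthogonal b k (LinearMap.range f)) β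
  have hmk : (LinearMap.ker f).mkQ (partialInverse b f β) = f.quotKerEquivRange.symm ρ :=
    Submodule.mk_quotientEquivOfIsCompl_apply (isCompl_orthogonal b h (LinearMap.ker f)) _
  exact congrArg Subtype.val ((LinearEquiv.eq_symm_apply _).1 hmk)

theorem covInner_map_partialInverse_sub (β : Covec E k) (κ : Covec E h) :
    covInner b k (f κ) (f (partialInverse b f β) - β) = 0 := by
  have hmem : f (partialInverse b f β) - β ∈ (covInner b k).orthogonal (LinearMap.range f) := by
    rw [map_partialInverse, ← Submodule.projectionOnto_apply_eq_zero_iff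
      (isCompl_orthogonal b k (LinearMap.range f)), map_sub, Submodule.projectionOnto_apply_left,
      sub_self]
  exact hmem (f κ) ⟨κ, rfl⟩

theorem eq_partialInverse {α : Covec E h} {β : Covec E k}
    (hα : ∀ κ, f κ = 0 → covInner b h κ α = 0)
    (hβ : ∀ κ, covInner b k (f κ) (f α - β) = 0) : α = partialInverse b f β := by
  have hker : f (α - partialInverse b f β) = 0 := by
    refine eq_zero_of_covInner_self b ?_
    have hsub : f (α - partialInverse b f β) = (f α - β) - (f (partialInverse b f β) - β) := by
      rw [map_sub, sub_sub_sub_cancel_right]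
    nth_rewrite 2 [hsub]
    rw [map_sub, hβ, covInner_map_partialInverse_sub, sub_zero]
  refine sub_eq_zero.1 (eq_zero_of_covInner_self b ?_)
  rw [map_sub, hα _ hker, covInner_partialInverse b f β hker, sub_zero]

theorem map_partialInverse_map (α : Covec E h) : f (partialInverse b f (f α)) = f α := by
  rw [map_partialInverse]
  exact congrArg Subtype.val (Submodule.projectionOnto_apply_left
    (isCompl_orthogonal b k (LinearMap.range f)) ⟨f α, α, rfl⟩)

theorem partialInverse_map_partialInverse (β : Covec E k) :
    partialInverse b f (f (partialInverse b f β)) = partialInverse b f β :=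
  (eq_partialInverse b f (fun _ hκ => covInner_partialInverse b f β hκ)
    fun κ => by rw [sub_self, map_zero]).symm

theorem partialInverse_eq_zero {β : Covec E k} (hβ : ∀ κ, covInner b k (f κ) β = 0) :
    partialInverse b f β = 0 :=
  (eq_partialInverse b f (fun _ _ => map_zero _)
    fun κ => by rw [map_zero, zero_sub, map_neg, hβ, neg_zero]).symm

theorem covInner_map_eq_zero {β : Covec E k} (hβ : partialInverse b f β = 0) (κ : Covec E h) :
    covInner b k (f κ) β = 0 := by
  have := covInner_map_partialInverse_sub b f β κ
  rwa [hβ, map_zero, zero_sub, map_neg, neg_eq_zero] at this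

theorem partialInverse_partialInverse {l : ℕ} (g : Covec E k →ₗ[ℝ] Covec E l)
    (hgf : ∀ κ, g (f κ) = 0) (β : Covec E l) :
    partialInverse b f (partialInverse b g β) = 0 :=
  partialInverse_eq_zero b f fun κ => covInner_partialInverse b g β (hgf κ)

theorem partialInverse_covProj (w : Fin n → ℕ) (a : ℤ)
    (hf : ∀ κ, f (covProj b w h a κ) = covProj b w k a (f κ)) (β : Covec E k) :
    partialInverse b f (covProj b w k a β) = covProj b w h a (partialInverse b f β) := by
  refine (eq_partialInverse b f (fun κ hκ => ?_) fun κ => ?_).symm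
  · rw [covInner_covProj]
    exact covInner_partialInverse b f β (by rw [hf, hκ, map_zero])
  · rw [hf, ← map_sub, covInner_covProj, ← hf]
    exact covInner_map_partialInverse_sub b f β _

end PartialInverse

section Operators
variable {E : Type*} [NormedAddCommGroup E] [NormedSpace ℝ E]
  {G : Type*} [TopologicalSpace G] [ChartedSpace E G]

/-- The value at `x` of the component of degree `h` of a form. -/
def Forms.evalAt (h : ℕ) (x : G) : Forms E G →ₗ[ℝ] Covec E h where
  toFun α := α h x
  map_add' _ _ := rfl
  map_smul' _ _ := rfl

theorem Forms.ext_evalAt {α β : Forms E G}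
    (H : ∀ h x, Forms.evalAt h x α = Forms.evalAt h x β) : α = β := by
  funext h
  ext1 x
  exact H h x

variable [Group G]

namespace AdaptedBasis
variable {S : Stratification E G} {n : ℕ} (A : AdaptedBasis S n)

theorem one_le_weight (i : Fin n) : 1 ≤ A.weight i := by
  refine Nat.one_le_iff_ne_zero.2 fun h0 => A.basis.ne_zero i ?_
  rw [← Submodule.mem_bot ℝ, ← S.layer_zero, ← h0]
  exact A.mem_layer i

theorem repr_eq_zero_of_mem_layer {m : ℕ} {x : GroupLieAlgebra 𝓘(ℝ, E) G} (hx : x ∈ S.layer m)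
    {k : Fin n} (hk : A.weight k ≠ m) : A.basis.repr x k = 0 := by
  set y := ∑ k with A.weight k = m, A.basis.repr x k • A.basis k
  set z := ∑ k with ¬ A.weight k = m, A.basis.repr x k • A.basis k
  have hyz : y + z = x := (Finset.sum_filter_add_sum_filter_not _ _ _).trans (A.basis.sum_repr x)
  have hy : y ∈ S.layer m := Submodule.sum_mem _ fun k hk =>
    Submodule.smul_mem _ _ ((Finset.mem_filter.1 hk).2 ▸ A.mem_layer k)
  have hz : z ∈ S.layer m := eq_sub_of_add_eq' hyz ▸ Submodule.sub_mem _ hx hy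
  have hz' : z ∈ ⨆ j, ⨆ (_ : j ≠ m), S.layer j := Submodule.sum_mem _ fun k hk =>
    Submodule.smul_mem _ _ (Submodule.mem_iSup_of_mem (A.weight k)
      (Submodule.mem_iSup_of_mem (Finset.mem_filter.1 hk).2 (A.mem_layer k)))
  have hz0 : z = 0 := Submodule.disjoint_def.1 (S.isInternal.submodule_iSupIndep m) z hz hz'
  exact linearIndependent_iff'.1 A.basis.linearIndependent _ _ hz0 k
    (Finset.mem_filter.2 ⟨Finset.mem_univ k, hk⟩)

variable {A} in
theorem Ortho.symm {α β : Forms E G} (h : A.Ortho α β) : A.Ortho β α :=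
  fun k x => (covInner_comm A.frame _ _).trans (h k x)

variable {A} in
theorem Ortho.add_right {α β γ : Forms E G} (hβ : A.Ortho α β) (hγ : A.Ortho α γ) :
    A.Ortho α (β + γ) := fun k x =>
  (map_add (covInner A.frame k (α k x)) (β k x) (γ k x)).trans (by rw [hβ, hγ, add_zero])

variable {A} in
theorem Ortho.sub_left {α β γ : Forms E G} (hα : A.Ortho α γ) (hβ : A.Ortho β γ) :
    A.Ortho (α - β) γ := fun k x =>
  (LinearMap.map_sub₂ (covInner A.frame k) (α k x) (β k x) (γ k x)).trans
    (by rw [hα, hβ, sub_zero])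

theorem eq_zero_of_ortho_self {α : Forms E G} (h : A.Ortho α α) : α = 0 :=
  Forms.ext_evalAt fun k x => eq_zero_of_covInner_self A.frame (h k x)

theorem modelBracket_frame (i j : Fin n) :
    modelBracket G (A.frame i) (A.frame j) =
      ∑ k with A.weight k = A.weight i + A.weight j,
        A.frame.repr (modelBracket G (A.frame i) (A.frame j)) k • A.frame k := by
  have hlayer : Membership.mem (γ := Submodule ℝ (GroupLieAlgebra 𝓘(ℝ, E) G))
      (S.layer (A.weight i + A.weight j)) (modelBracket G (A.frame i) (A.frame j)) :=
    S.bracket_mem _ _ _ _ (A.mem_layer i) (A.mem_layer j)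
  rw [Finset.sum_filter_of_ne, A.frame.sum_repr]
  intro k _ hk
  contrapose! hk
  exact smul_eq_zero_of_left (A.repr_eq_zero_of_mem_layer hlayer hk) _

theorem apply_modelBracket_frame {h : ℕ} (ξ : Covec E (h + 1)) (i j : Fin n) (u : Fin h → E) :
    ξ (Matrix.vecCons (modelBracket G (A.frame i) (A.frame j)) u) =
      ∑ k with A.weight k = A.weight i + A.weight j,
        A.frame.repr (modelBracket G (A.frame i) (A.frame j)) k •
          ξ (Matrix.vecCons (A.frame k) u) := by
  change ξ.curryLeft (modelBracket G (A.frame i) (A.frame j)) u = _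
  conv_lhs => rw [A.modelBracket_frame]
  rw [map_sum, ContinuousAlternatingMap.sum_apply]
  refine Finset.sum_congr rfl fun k _ => ?_
  rw [map_smul]
  rfl

theorem sum_weight_vecCons_removeNth {h : ℕ} (K : Fin (h + 2) → Fin n) {i j : Fin (h + 1)}
    (hij : i ≤ j) {k : Fin n} (hk : A.weight k = A.weight (K i.castSucc) + A.weight (K j.succ)) :
    ∑ l, (A.weight (Matrix.vecCons k (j.removeNth (i.castSucc.removeNth K)) l) : ℤ) =
      ∑ l, (A.weight (K l) : ℤ) := by
  have hj : i.castSucc.succAbove j = j.succ :=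
    Fin.succAbove_of_le_castSucc _ _ (Fin.castSucc_le_castSucc_iff.2 hij)
  rw [Fin.sum_univ_succ, Fin.sum_univ_succAbove _ i.castSucc, Fin.sum_univ_succAbove _ j, hj]
  simp only [Fin.removeNth, Matrix.cons_val_zero, Matrix.cons_val_succ, hk]
  push_cast
  ring

variable [FiniteDimensional ℝ E]

theorem evalAt_wproj (a : ℤ) (α : Forms E G) (h : ℕ) (x : G) :
    Forms.evalAt h x (A.wproj a α) = covProj A.frame A.weight h a (Forms.evalAt h x α) := rfl

theorem wproj_wproj (a c : ℤ) (α : Forms E G) :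
    A.wproj a (A.wproj c α) = if a = c then A.wproj a α else 0 := by
  refine Forms.ext_evalAt fun h x => ?_
  rw [evalAt_wproj, evalAt_wproj, covProj_covProj]
  split_ifs <;> rfl

theorem wproj_eq_zero {a : ℤ} (ha : a < 0 ∨ (A.homDim : ℤ) < a) (α : Forms E G) :
    A.wproj a α = 0 := by
  refine Forms.ext_evalAt fun h x => ?_
  rw [evalAt_wproj, covProj_eq_zero _ _ ha, map_zero]

theorem sum_wproj (α : Forms E G) : ∑ a ∈ Finset.range (A.homDim + 1), A.wproj a α = α := by
  refine Forms.ext_evalAt fun h x => ?_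
  rw [map_sum]
  exact sum_covProj A.frame A.weight _

end AdaptedBasis

variable [FiniteDimensional ℝ E] [LieGroup 𝓘(ℝ, E) ∞ G]

theorem deRham_const {h : ℕ} (ξ : Covec E h) :
    deRham (E := E) (G := G) h ⟨fun _ => ξ, contMDiff_const⟩ =
      ⟨fun _ => covD0 E G h ξ, contMDiff_const⟩ := by
  ext1 x
  ext v
  refine (deRham_apply _ x v).trans (add_eq_right.2 (Finset.sum_eq_zero fun i _ => ?_))
  change (-1) ^ i.val • fderiv ℝ (fun _ : E => ξ (i.removeNth v)) _ _ = 0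
  rw [fderiv_const_apply, zero_apply, smul_zero]

theorem covD0_covD0 {h : ℕ} (ξ : Covec E h) : covD0 E G (h + 1) (covD0 E G h ξ) = 0 := by
  have hd := deRham_deRham (E := E) (G := G) (h := h) ⟨fun _ => ξ, contMDiff_const⟩
  rw [deRham_const] at hd
  exact congrArg (fun β : Form E G (h + 1 + 1) => β 1) hd

theorem Forms.evalAt_succ_d (α : Forms E G) (h : ℕ) (x : G) :
    Forms.evalAt (h + 1) x (d E G α) = deRham (E := E) (G := G) h (α h) x := rfl

theorem Forms.evalAt_zero_d (α : Forms E G) (x : G) : Forms.evalAt 0 x (d E G α) = 0 := rfl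

namespace AdaptedBasis
variable {S : Stratification E G} {n : ℕ} (A : AdaptedBasis S n)

theorem covD0_apply_frame_eq_zero {h : ℕ} {ξ : Covec E h} {t : ℤ}
    (hξ : ∀ K : Fin h → Fin n, ∑ i, (A.weight (K i) : ℤ) = t → ξ (fun i => A.frame (K i)) = 0)
    (K : Fin (h + 1) → Fin n) (hK : ∑ i, (A.weight (K i) : ℤ) = t) :
    covD0 E G h ξ (fun i => A.frame (K i)) = 0 := by
  rw [covD0_apply]
  cases h with
  | zero => rfl
  | succ h =>
    rw [lieTerm, neg_eq_zero]
    refine Finset.sum_eq_zero fun i _ => Finset.sum_eq_zero fun j hij => ?_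
    rw [apply_modelBracket_frame, Finset.sum_eq_zero fun k hk => ?_, smul_zero]
    have hcons : Matrix.vecCons (A.frame k) (j.removeNth (i.castSucc.removeNth
        fun i => A.frame (K i))) = fun l => A.frame (Matrix.vecCons k
        (j.removeNth (i.castSucc.removeNth K)) l) :=
      funext (Fin.cases rfl fun _ => rfl)
    rw [hcons, hξ, smul_zero]
    rw [A.sum_weight_vecCons_removeNth K (Finset.mem_Ici.1 hij) (Finset.mem_filter.1 hk).2, hK]

theorem covD0_covProj {h : ℕ} (a : ℤ) (ξ : Covec E h) :
    covD0 E G h (covProj A.frame A.weight h a ξ) =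
      covProj A.frame A.weight (h + 1) a (covD0 E G h ξ) := by
  refine eq_of_incr A.frame fun K _ => ?_
  rw [covProj_apply]
  split_ifs with hK
  · have hsub := A.covD0_apply_frame_eq_zero (ξ := covProj A.frame A.weight h a ξ - ξ) (t := a)
      (fun J hJ => by
        rw [ContinuousAlternatingMap.sub_apply, covProj_apply, if_pos hJ, sub_self]) K hK
    rwa [map_sub, ContinuousAlternatingMap.sub_apply, sub_eq_zero] at hsub
  · exact A.covD0_apply_frame_eq_zero (fun J hJ => by rw [covProj_apply, hJ, if_neg hK]) K rfl

theorem evalAt_d0inv (α : Forms E G) (h : ℕ) (x : G) :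
    Forms.evalAt h x (A.d0inv α) =
      partialInverse A.frame (covD0 E G h) (Forms.evalAt (h + 1) x α) := rfl

/-- The derivative terms in Koszul's formula `dFun_apply` raise the weight, since every
left-invariant vector field has weight at least `1`. -/
theorem evalAt_d_wproj {h : ℕ} {a : ℤ} (α : Forms E G) (x : G) (K : Fin (h + 1) → Fin n)
    (hK : ∑ i, (A.weight (K i) : ℤ) ≤ a) :
    Forms.evalAt (h + 1) x (d E G (A.wproj a α)) (fun i => A.frame (K i)) =
      covD0 E G h (Forms.evalAt h x (A.wproj a α)) (fun i => A.frame (K i)) := by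
  rw [Forms.evalAt_succ_d, deRham_apply]
  refine add_eq_right.2 (Finset.sum_eq_zero fun i _ => ?_)
  have hcoeff (y : G) : (A.wproj a α h) y (i.removeNth fun i => A.frame (K i)) = 0 := by
    refine (covProj_apply A.frame A.weight a (α h y) (i.removeNth K)).trans (if_neg ?_)
    rw [Fin.sum_univ_succAbove _ i] at hK
    have := A.one_le_weight (K i)
    simp only [Fin.removeNth]
    omega
  simp only [hcoeff]
  rw [fderiv_const_apply, zero_apply, smul_zero]

theorem wproj_d_wproj_of_lt {a c : ℤ} (hc : c < a) (α : Forms E G) :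
    A.wproj c (d E G (A.wproj a α)) = 0 := by
  refine Forms.ext_evalAt fun h x => ?_
  cases h with
  | zero => rw [evalAt_wproj, Forms.evalAt_zero_d, map_zero, map_zero]
  | succ h =>
    rw [map_zero, evalAt_wproj]
    refine eq_zero_of_incr A.frame _ fun K _ => ?_
    rw [covProj_apply]
    split_ifs with hK
    · rw [A.evalAt_d_wproj α x K (by omega), evalAt_wproj, covD0_covProj, covProj_apply,
        if_neg (by omega)]
    · rfl

theorem evalAt_wproj_d_wproj (a : ℤ) (α : Forms E G) (h : ℕ) (x : G) :
    Forms.evalAt (h + 1) x (A.wproj a (d E G (A.wproj a α))) =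
      covD0 E G h (Forms.evalAt h x (A.wproj a α)) := by
  refine eq_of_incr A.frame fun K _ => ?_
  rw [evalAt_wproj, covProj_apply]
  split_ifs with hK
  · rw [A.evalAt_d_wproj α x K hK.le]
  · rw [evalAt_wproj, covD0_covProj, covProj_apply, if_neg hK]

theorem evalAt_succ_dW_zero (α : Forms E G) (h : ℕ) (x : G) :
    Forms.evalAt (h + 1) x (A.dW 0 α) = covD0 E G h (Forms.evalAt h x α) := by
  conv_rhs => rw [← A.sum_wproj α, map_sum, map_sum]
  rw [dW, LinearMap.sum_apply, map_sum]
  refine Finset.sum_congr rfl fun a _ => ?_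
  rw [← evalAt_wproj_d_wproj, Nat.cast_zero, add_zero]
  rfl

theorem evalAt_zero_dW_zero (α : Forms E G) (x : G) : Forms.evalAt 0 x (A.dW 0 α) = 0 := by
  rw [dW, LinearMap.sum_apply, map_sum]
  refine Finset.sum_eq_zero fun a _ => ?_
  rw [Module.End.mul_apply, Module.End.mul_apply, evalAt_wproj, Forms.evalAt_zero_d, map_zero]

theorem dW_zero_dW_zero (α : Forms E G) : A.dW 0 (A.dW 0 α) = 0 := by
  refine Forms.ext_evalAt fun h x => ?_
  match h with
  | 0 => rw [evalAt_zero_dW_zero, map_zero]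
  | 1 => rw [evalAt_succ_dW_zero, evalAt_zero_dW_zero, map_zero, map_zero]
  | h + 2 => rw [evalAt_succ_dW_zero, evalAt_succ_dW_zero, covD0_covD0, map_zero]

theorem d0inv_d0inv (α : Forms E G) : A.d0inv (A.d0inv α) = 0 := by
  refine Forms.ext_evalAt fun h x => ?_
  rw [evalAt_d0inv, evalAt_d0inv, partialInverse_partialInverse _ _ _ covD0_covD0, map_zero]

theorem dW_zero_d0inv_dW_zero (α : Forms E G) : A.dW 0 (A.d0inv (A.dW 0 α)) = A.dW 0 α := by
  refine Forms.ext_evalAt fun h x => ?_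
  cases h with
  | zero => rw [evalAt_zero_dW_zero, evalAt_zero_dW_zero]
  | succ h => rw [evalAt_succ_dW_zero, evalAt_d0inv, evalAt_succ_dW_zero, map_partialInverse_map]

theorem d0inv_dW_zero_d0inv (α : Forms E G) : A.d0inv (A.dW 0 (A.d0inv α)) = A.d0inv α := by
  refine Forms.ext_evalAt fun h x => ?_
  rw [evalAt_d0inv, evalAt_succ_dW_zero, evalAt_d0inv, partialInverse_map_partialInverse]

theorem wproj_d0inv (a : ℤ) (α : Forms E G) : A.wproj a (A.d0inv α) = A.d0inv (A.wproj a α) := by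
  refine Forms.ext_evalAt fun h x => ?_
  rw [evalAt_wproj, evalAt_d0inv, evalAt_d0inv, evalAt_wproj,
    partialInverse_covProj _ _ _ _ (A.covD0_covProj a)]

theorem ortho_d0inv (β : Forms E G) {κ : Forms E G} (hκ : A.dW 0 κ = 0) :
    A.Ortho (A.d0inv β) κ := by
  intro h x
  change covInner A.frame h (Forms.evalAt h x (A.d0inv β)) (Forms.evalAt h x κ) = 0
  rw [covInner_comm, evalAt_d0inv]
  refine covInner_partialInverse _ _ _ ?_
  rw [← A.evalAt_succ_dW_zero, hκ, map_zero]

theorem dW_zero_ortho {α : Forms E G} (hα : A.d0inv α = 0) (β : Forms E G) :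
    A.Ortho α (A.dW 0 β) := by
  intro h x
  change covInner A.frame h (Forms.evalAt h x α) (Forms.evalAt h x (A.dW 0 β)) = 0
  rw [covInner_comm]
  cases h with
  | zero => rw [evalAt_zero_dW_zero, LinearMap.map_zero₂]
  | succ h =>
    rw [evalAt_succ_dW_zero]
    refine covInner_map_eq_zero _ _ ?_ _
    rw [← evalAt_d0inv, hα, map_zero]

theorem ortho_dW_zero_d0inv_sub (α β : Forms E G) :
    A.Ortho (A.dW 0 β) (A.dW 0 (A.d0inv α) - α) := by
  intro h x
  change covInner A.frame h (Forms.evalAt h x (A.dW 0 β))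
    (Forms.evalAt h x (A.dW 0 (A.d0inv α) - α)) = 0
  cases h with
  | zero => rw [evalAt_zero_dW_zero, LinearMap.map_zero₂]
  | succ h =>
    rw [map_sub, evalAt_succ_dW_zero, evalAt_succ_dW_zero, evalAt_d0inv]
    exact covInner_map_partialInverse_sub _ _ _ _

theorem d0inv_eq_zero_iff {α : Forms E G} : A.d0inv α = 0 ↔ ∀ β, A.Ortho α (A.dW 0 β) := by
  refine ⟨A.dW_zero_ortho, fun hα => ?_⟩
  have hself : A.Ortho (A.dW 0 (A.d0inv α)) (A.dW 0 (A.d0inv α)) := by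
    simpa only [sub_add_cancel] using
      (A.ortho_dW_zero_d0inv_sub α (A.d0inv α)).add_right ((hα _).symm)
  rw [← d0inv_dW_zero_d0inv, A.eq_zero_of_ortho_self hself, map_zero]

theorem mem_ruminForms {α : Forms E G} : α ∈ A.ruminForms ↔ A.dW 0 α = 0 ∧ A.d0inv α = 0 :=
  and_congr_right fun _ => A.d0inv_eq_zero_iff.symm

theorem d0inv_dW_zero_of_ortho {z : Forms E G} (hz : ∀ κ, A.dW 0 κ = 0 → A.Ortho z κ) :
    A.d0inv (A.dW 0 z) = z := by
  have hker : A.dW 0 (A.d0inv (A.dW 0 z) - z) = 0 := by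
    rw [map_sub, dW_zero_d0inv_dW_zero, sub_self]
  exact sub_eq_zero.1 (A.eq_zero_of_ortho_self
    ((A.ortho_d0inv (A.dW 0 z) hker).sub_left (hz _ hker)))

end AdaptedBasis
end Operators

section RuminComplex
variable {E : Type*} [NormedAddCommGroup E] [NormedSpace ℝ E]
  {G : Type*} [TopologicalSpace G] [ChartedSpace E G] [Group G] [FiniteDimensional ℝ E]

namespace AdaptedBasis
variable {S : Stratification E G} {n : ℕ} (A : AdaptedBasis S n)

theorem mem_weightForms {a : ℤ} {x : Forms E G} : x ∈ A.weightForms a ↔ A.wproj a x = x := by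
  refine ⟨?_, fun hx => ⟨x, hx⟩⟩
  rintro ⟨y, rfl⟩
  rw [wproj_wproj, if_pos rfl]

theorem wproj_mem_weightForms (a : ℤ) (x : Forms E G) : A.wproj a x ∈ A.weightForms a := ⟨x, rfl⟩

theorem wproj_of_mem_weightForms {a c : ℤ} {x : Forms E G} (hx : x ∈ A.weightForms a) :
    A.wproj c x = if c = a then x else 0 := by
  rw [← A.mem_weightForms.1 hx, wproj_wproj]
  split_ifs with h
  · rw [h]
  · rfl

theorem mem_filtration {p : ℤ} {x : Forms E G} :
    x ∈ A.filtration p ↔ ∀ a < p, A.wproj a x = 0 := by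
  simp [filtration, Submodule.mem_iInf]

theorem filtration_antitone : Antitone A.filtration := fun _ _ hpq _ hx =>
  A.mem_filtration.2 fun a ha => A.mem_filtration.1 hx a (by omega)

theorem weightForms_le_filtration (a : ℤ) : A.weightForms a ≤ A.filtration a :=
  fun _ hx => A.mem_filtration.2 fun c hc => by
    rw [A.wproj_of_mem_weightForms hx, if_neg hc.ne]

theorem filtration_zero : A.filtration 0 = ⊤ :=
  Submodule.eq_top_iff'.2 fun x =>
    A.mem_filtration.2 fun _ ha => A.wproj_eq_zero (Or.inl ha) x

theorem ext_wproj {x y : Forms E G} (H : ∀ a, A.wproj a x = A.wproj a y) : x = y := by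
  rw [← A.sum_wproj x, ← A.sum_wproj y]
  exact Finset.sum_congr rfl fun a _ => H a

theorem filtration_eq_bot {p : ℤ} (hp : (A.homDim : ℤ) < p) : A.filtration p = ⊥ := by
  refine (Submodule.eq_bot_iff _).2 fun x hx => A.ext_wproj fun a => ?_
  rw [map_zero]
  rcases lt_or_ge a p with h | h
  · exact A.mem_filtration.1 hx a h
  · exact A.wproj_eq_zero (Or.inr (by omega)) x

theorem mem_filtration_add_iff {r : ℕ} {p : ℤ} {x : Forms E G} (hx : x ∈ A.filtration p) :
    x ∈ A.filtration (p + r) ↔ ∀ m < r, A.wproj (p + m) x = 0 := by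
  refine ⟨fun h m hm => A.mem_filtration.1 h _ (by omega),
    fun h => A.mem_filtration.2 fun a ha => ?_⟩
  rcases lt_or_ge a p with hap | hap
  · exact A.mem_filtration.1 hx a hap
  · obtain ⟨m, rfl⟩ := Int.exists_add_of_le hap
    exact h m (by omega)

theorem mem_filtration_succ {p : ℤ} {x : Forms E G} (hx : x ∈ A.filtration p)
    (h0 : A.wproj p x = 0) : x ∈ A.filtration (p + 1) := by
  simpa [h0] using A.mem_filtration_add_iff (r := 1) hx

theorem wproj_sub_sum_range {r : ℕ} {p : ℤ} {c : ℕ → Forms E G}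
    (hc : ∀ k < r, c k ∈ A.weightForms (p - k)) {k : ℕ} (hk : k < r) :
    A.wproj (p - k) (∑ j ∈ Finset.range r, c j) = c k := by
  have hcj : ∀ j ∈ Finset.range r, A.wproj (p - k) (c j) = if k = j then c j else 0 := by
    intro j hj
    simp [A.wproj_of_mem_weightForms (hc j (Finset.mem_range.1 hj))]
  rw [map_sum, Finset.sum_congr rfl hcj, Finset.sum_ite_eq, if_pos (Finset.mem_range.2 hk)]

theorem sum_wproj_add {p : ℤ} {N : ℕ} (hN : (A.homDim : ℤ) ≤ p + N) {x : Forms E G}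
    (hx : x ∈ A.filtration p) : ∑ i ∈ Finset.range (N + 1), A.wproj (p + i) x = x := by
  refine A.ext_wproj fun c => ?_
  rw [map_sum]
  simp only [wproj_wproj]
  rcases lt_or_ge c p with hc | hc
  · rw [A.mem_filtration.1 hx c hc]
    exact Finset.sum_eq_zero fun i _ => if_neg (by omega)
  rw [Finset.sum_eq_single (c - p).toNat (fun i _ hi => if_neg (by omega)) fun hi => ?_,
    if_pos (by omega)]
  rw [Finset.mem_range] at hi
  rw [if_pos (by omega)]
  exact A.wproj_eq_zero (Or.inr (by omega)) x

theorem mem_shiftEnd_filtration {k : ℤ} {T : Module.End ℝ (Forms E G)}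
    (hT : ∀ a x, A.wproj a (T x) = T (A.wproj (a - k) x)) : T ∈ shiftEnd A.filtration k :=
  fun p x hx => A.mem_filtration.2 fun a ha => by
    rw [hT, A.mem_filtration.1 hx _ (by omega), map_zero]

variable [LieGroup 𝓘(ℝ, E) ∞ G]

theorem dW_apply (i : ℕ) (x : Forms E G) :
    A.dW i x = ∑ a ∈ Finset.range (A.homDim + 1), A.wproj ((a : ℤ) + i) (d E G (A.wproj a x)) := by
  rw [dW, LinearMap.sum_apply]
  rfl

theorem dW_wproj (i : ℕ) (a : ℤ) (x : Forms E G) :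
    A.dW i (A.wproj a x) = A.wproj (a + i) (d E G (A.wproj a x)) := by
  rw [dW_apply]
  by_cases ha : a < 0 ∨ (A.homDim : ℤ) < a
  · simp only [A.wproj_eq_zero ha x, map_zero, Finset.sum_const_zero]
  rw [Finset.sum_eq_single a.toNat, wproj_wproj, if_pos (by omega), Int.toNat_of_nonneg (by omega)]
  · intro c _ hc
    rw [wproj_wproj, if_neg (by omega), map_zero, map_zero]
  · intro hc
    rw [Finset.mem_range] at hc
    omega

theorem wproj_dW (i : ℕ) (c : ℤ) (x : Forms E G) :
    A.wproj c (A.dW i x) = A.dW i (A.wproj (c - i) x) := by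
  conv_lhs => rw [← A.sum_wproj x, map_sum, map_sum]
  conv_rhs => rw [← A.sum_wproj x, map_sum, map_sum]
  refine Finset.sum_congr rfl fun a _ => ?_
  rw [wproj_wproj, dW_wproj, wproj_wproj]
  by_cases h : c = a + i
  · rw [if_pos h, if_pos (by omega), dW_wproj, h, add_sub_cancel_right]
  · rw [if_neg h, if_neg (by omega), map_zero]

theorem wproj_dW_zero (a : ℤ) (x : Forms E G) : A.wproj a (A.dW 0 x) = A.dW 0 (A.wproj a x) := by
  rw [wproj_dW, Nat.cast_zero, sub_zero]

theorem d_eq_sum {N : ℕ} (hN : A.homDim ≤ N) : d E G = ∑ i ∈ Finset.range (N + 1), A.dW i := by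
  ext1 x
  rw [LinearMap.sum_apply]
  simp only [dW_apply]
  rw [Finset.sum_comm]
  conv_lhs => rw [← A.sum_wproj x, map_sum]
  refine Finset.sum_congr rfl fun a _ => ?_
  refine (A.sum_wproj_add (by omega) (A.mem_filtration.2 fun c hc => ?_)).symm
  exact A.wproj_d_wproj_of_lt hc x

theorem wproj_add_d {p : ℤ} (m : ℕ) {x : Forms E G} (hx : x ∈ A.filtration p) :
    A.wproj (p + m) (d E G x) =
      ∑ i ∈ Finset.range (m + 1), A.dW i (A.wproj (p + (m - i : ℕ)) x) := by
  rw [A.d_eq_sum (N := A.homDim + m) (by omega), LinearMap.sum_apply, map_sum]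
  simp only [wproj_dW]
  have hsub : Finset.range (m + 1) ⊆ Finset.range (A.homDim + m + 1) :=
    Finset.range_subset_range.2 (by omega)
  rw [← Finset.sum_subset hsub fun i _ hi => ?_]
  · refine Finset.sum_congr rfl fun i hi => ?_
    rw [Finset.mem_range] at hi
    congr 3
    omega
  · rw [Finset.mem_range] at hi
    rw [A.mem_filtration.1 hx _ (by omega), map_zero]

theorem dW_mem_shiftEnd (i : ℕ) : A.dW i ∈ shiftEnd A.filtration i :=
  A.mem_shiftEnd_filtration (A.wproj_dW i)

theorem d_mem_shiftEnd : d E G ∈ shiftEnd A.filtration 0 := by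
  rw [A.d_eq_sum le_rfl]
  exact Submodule.sum_mem _ fun i _ =>
    shiftEnd_antitone A.filtration_antitone (Int.natCast_nonneg i) (A.dW_mem_shiftEnd i)

theorem d_mem_filtration {p : ℤ} {x : Forms E G} (hx : x ∈ A.filtration p) :
    d E G x ∈ A.filtration p :=
  apply_mem_of_mem_shiftEnd A.d_mem_shiftEnd (add_zero p) hx

theorem d_sub_dW_zero_mem_shiftEnd : d E G - A.dW 0 ∈ shiftEnd A.filtration 1 := by
  rw [A.d_eq_sum le_rfl, Finset.sum_range_succ', add_sub_cancel_right]
  exact Submodule.sum_mem _ fun i _ =>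
    shiftEnd_antitone A.filtration_antitone (by omega) (A.dW_mem_shiftEnd (i + 1))

theorem d0inv_mem_shiftEnd : A.d0inv ∈ shiftEnd A.filtration 0 :=
  A.mem_shiftEnd_filtration fun a x => by rw [sub_zero, wproj_d0inv]

theorem wproj_projE0 (a : ℤ) (x : Forms E G) :
    A.wproj a (A.projE0 x) = A.projE0 (A.wproj a x) := by
  simp only [projE0, LinearMap.sub_apply, Module.End.mul_apply, Module.End.one_apply, map_sub,
    wproj_dW_zero, wproj_d0inv]

theorem projE0_mem_shiftEnd : A.projE0 ∈ shiftEnd A.filtration 0 :=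
  A.mem_shiftEnd_filtration fun a x => by rw [sub_zero, wproj_projE0]

theorem nilOp_mem_shiftEnd : A.nilOp ∈ shiftEnd A.filtration 1 :=
  mul_mem_shiftEnd A.d0inv_mem_shiftEnd A.d_sub_dW_zero_mem_shiftEnd (zero_add 1)

theorem nilOp_pow_eq_zero : A.nilOp ^ (A.homDim + 1) = 0 := by
  ext1 x
  have hx : x ∈ A.filtration 0 := A.filtration_zero ▸ Submodule.mem_top
  have hpow := apply_mem_of_mem_shiftEnd (pow_mem_shiftEnd A.nilOp_mem_shiftEnd (A.homDim + 1))
    rfl hx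
  rwa [A.filtration_eq_bot (by push_cast; omega), Submodule.mem_bot] at hpow

theorem P_mem_shiftEnd_of_nilOp_mem_shiftEnd {F : ℤ → Submodule ℝ (Forms E G)}
    (hN : A.nilOp ∈ shiftEnd F 0) : A.P ∈ shiftEnd F 0 :=
  Submodule.sum_mem _ fun k _ => Submodule.smul_mem _ _ (by simpa using pow_mem_shiftEnd hN k)

theorem P_mem_shiftEnd : A.P ∈ shiftEnd A.filtration 0 :=
  A.P_mem_shiftEnd_of_nilOp_mem_shiftEnd
    (shiftEnd_antitone A.filtration_antitone zero_le_one A.nilOp_mem_shiftEnd)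

theorem homotopyPerturbation : HomotopyPerturbation (d E G) (A.dW 0) A.d0inv A.P where
  d_mul_d := LinearMap.ext d_d
  d₀_mul_d₀ := LinearMap.ext A.dW_zero_dW_zero
  δ_mul_δ := LinearMap.ext A.d0inv_d0inv
  d₀_mul_δ_mul_d₀ := LinearMap.ext A.dW_zero_d0inv_dW_zero
  δ_mul_d₀_mul_δ := LinearMap.ext A.d0inv_dW_zero_d0inv
  one_add_mul_P := one_add_mul_sum_neg_one_pow_smul A.nilOp_pow_eq_zero
  P_mul_one_add := sum_neg_one_pow_smul_mul_one_add A.nilOp_pow_eq_zero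

theorem P_eq_sub_nilOp_mul_P : A.P = 1 - A.nilOp * A.P := by
  have h := A.homotopyPerturbation.one_add_mul_P
  rw [add_mul, one_mul] at h
  exact eq_sub_of_add_eq h

theorem wproj_P_of_mem_filtration {p : ℤ} {x : Forms E G} (hx : x ∈ A.filtration p) :
    A.wproj p (A.P x) = A.wproj p x := by
  have hNP : A.nilOp (A.P x) ∈ A.filtration (p + 1) := A.nilOp_mem_shiftEnd p _
    (apply_mem_of_mem_shiftEnd A.P_mem_shiftEnd (add_zero p) hx)
  rw [P_eq_sub_nilOp_mul_P, LinearMap.sub_apply, map_sub, Module.End.mul_apply,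
    A.mem_filtration.1 hNP p (lt_add_one p), sub_zero, Module.End.one_apply]

theorem projE0_mem_ruminForms (x : Forms E G) : A.projE0 x ∈ A.ruminForms :=
  A.mem_ruminForms.2 ⟨LinearMap.congr_fun A.homotopyPerturbation.d₀_mul_projE0 x,
    LinearMap.congr_fun A.homotopyPerturbation.δ_mul_projE0 x⟩

theorem projE0_dW_zero (x : Forms E G) : A.projE0 (A.dW 0 x) = 0 :=
  LinearMap.congr_fun A.homotopyPerturbation.projE0_mul_d₀ x

theorem dc_mem_ruminForms (x : Forms E G) : A.dc x ∈ A.ruminForms := A.projE0_mem_ruminForms _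

theorem wproj_mem_ruminForms (a : ℤ) {x : Forms E G} (hx : x ∈ A.ruminForms) :
    A.wproj a x ∈ A.ruminForms := by
  rw [mem_ruminForms] at hx ⊢
  rw [← wproj_dW_zero, ← wproj_d0inv, hx.1, hx.2, map_zero]
  exact ⟨rfl, rfl⟩

theorem projE_of_mem_ruminForms {y : Forms E G} (hy : y ∈ A.ruminForms) : A.projE y = A.P y := by
  obtain ⟨hd0, hδ⟩ := A.mem_ruminForms.1 hy
  refine (LinearMap.congr_fun A.homotopyPerturbation.projE_eq y).trans ?_
  simp only [LinearMap.sub_apply, Module.End.mul_apply, hd0, hδ, map_zero, sub_zero]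

theorem dc_of_mem_ruminForms {y : Forms E G} (hy : y ∈ A.ruminForms) :
    A.dc y = A.projE0 (d E G (A.P y)) := by
  rw [← A.projE_of_mem_ruminForms hy]
  rfl

theorem P_dc {y : Forms E G} (hy : y ∈ A.ruminForms) : A.P (A.dc y) = d E G (A.P y) := by
  rw [← A.projE_of_mem_ruminForms hy]
  exact LinearMap.congr_fun A.homotopyPerturbation.P_mul_projE0_mul_d_mul_projE y

theorem P_projE0_projE (x : Forms E G) : A.P (A.projE0 (A.projE x)) = A.projE x :=
  LinearMap.congr_fun A.homotopyPerturbation.P_mul_projE0_mul_projE x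

end AdaptedBasis
end RuminComplex

section RuminDifferential
variable {E : Type*} [NormedAddCommGroup E] [NormedSpace ℝ E]
  {G : Type*} [TopologicalSpace G] [ChartedSpace E G]

/-- The forms that are homogeneous of degree `k`, with `k` an integer so that operators of degree
`-1` are covered by `shiftEnd`; for `k < 0` only the zero form is. -/
def Forms.intDegree (k : ℤ) : Submodule ℝ (Forms E G) where
  carrier := {α | ∀ h : ℕ, (h : ℤ) ≠ k → α h = 0}
  zero_mem' _ _ := rfl
  add_mem' {α β} hα hβ h hk := by
    change α h + β h = 0
    rw [hα h hk, hβ h hk, add_zero]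
  smul_mem' c α hα h hk := by
    change c • α h = 0
    rw [hα h hk, smul_zero]

theorem Forms.intDegree_natCast (h : ℕ) :
    Forms.intDegree (h : ℤ) = (Forms.degree h : Submodule ℝ (Forms E G)) :=
  Submodule.ext fun _ => ⟨fun H k hk => H k (by exact_mod_cast hk),
    fun H k hk => H k (by exact_mod_cast hk)⟩

theorem Forms.raise_mem_shiftEnd (T : ∀ h, Form E G h →ₗ[ℝ] Form E G (h + 1)) :
    Forms.raise T ∈ shiftEnd Forms.intDegree 1 := by
  intro k α hα h hk
  cases h with
  | zero => rfl
  | succ h => exact (congrArg (T h) (hα h fun hh => hk (by push_cast; omega))).trans (map_zero _)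

theorem Forms.lower_mem_shiftEnd (T : ∀ h, Form E G (h + 1) →ₗ[ℝ] Form E G h) :
    Forms.lower T ∈ shiftEnd Forms.intDegree (-1) := fun k α hα h hk =>
  (congrArg (T h) (hα (h + 1) fun hh => hk (by push_cast at hh; omega))).trans (map_zero _)

theorem Forms.keep_mem_shiftEnd (T : ∀ h, Form E G h →ₗ[ℝ] Form E G h) :
    Forms.keep T ∈ shiftEnd Forms.intDegree 0 := fun k α hα h hk =>
  (congrArg (T h) (hα h fun hh => hk (by omega))).trans (map_zero _)

variable [Group G] [FiniteDimensional ℝ E] [LieGroup 𝓘(ℝ, E) ∞ G]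

namespace AdaptedBasis
variable {S : Stratification E G} {n : ℕ} (A : AdaptedBasis S n)

theorem dW_mem_shiftEnd_intDegree (i : ℕ) : A.dW i ∈ shiftEnd Forms.intDegree 1 :=
  Submodule.sum_mem _ fun _ _ => mul_mem_shiftEnd
    (mul_mem_shiftEnd (Forms.keep_mem_shiftEnd _) (Forms.raise_mem_shiftEnd _) (zero_add 1))
    (Forms.keep_mem_shiftEnd _) (add_zero 1)

theorem P_mem_shiftEnd_intDegree : A.P ∈ shiftEnd Forms.intDegree 0 :=
  A.P_mem_shiftEnd_of_nilOp_mem_shiftEnd <| mul_mem_shiftEnd (Forms.lower_mem_shiftEnd _)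
    (Submodule.sub_mem _ (Forms.raise_mem_shiftEnd _) (A.dW_mem_shiftEnd_intDegree 0))
    (neg_add_cancel 1)

theorem projE0_mem_shiftEnd_intDegree : A.projE0 ∈ shiftEnd Forms.intDegree 0 :=
  Submodule.sub_mem _ (Submodule.sub_mem _ one_mem_shiftEnd
      (mul_mem_shiftEnd (A.dW_mem_shiftEnd_intDegree 0) (Forms.lower_mem_shiftEnd _)
        (add_neg_cancel 1)))
    (mul_mem_shiftEnd (Forms.lower_mem_shiftEnd _) (A.dW_mem_shiftEnd_intDegree 0)
      (neg_add_cancel 1))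

theorem projE_mem_shiftEnd_intDegree : A.projE ∈ shiftEnd Forms.intDegree 0 :=
  Submodule.sub_mem _ (Submodule.sub_mem _ one_mem_shiftEnd
      (mul_mem_shiftEnd
        (mul_mem_shiftEnd (Forms.raise_mem_shiftEnd _) A.P_mem_shiftEnd_intDegree (add_zero 1))
        (Forms.lower_mem_shiftEnd _) (add_neg_cancel 1)))
    (mul_mem_shiftEnd
      (mul_mem_shiftEnd A.P_mem_shiftEnd_intDegree (Forms.lower_mem_shiftEnd _) (zero_add (-1)))
      (Forms.raise_mem_shiftEnd _) (neg_add_cancel 1))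

theorem dc_mem_shiftEnd_intDegree : A.dc ∈ shiftEnd Forms.intDegree 1 :=
  mul_mem_shiftEnd
    (mul_mem_shiftEnd A.projE0_mem_shiftEnd_intDegree (Forms.raise_mem_shiftEnd _) (zero_add 1))
    A.projE_mem_shiftEnd_intDegree (add_zero 1)

theorem dc_mem_degree_succ {h : ℕ} {α : Forms E G} (hα : α ∈ Forms.degree h) :
    A.dc α ∈ Forms.degree (h + 1) := by
  rw [← Forms.intDegree_natCast] at hα ⊢
  exact apply_mem_of_mem_shiftEnd A.dc_mem_shiftEnd_intDegree (Nat.cast_succ h).symm hα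

theorem diffPart_apply (r : ℕ) (x : Forms E G) :
    A.diffPart r x = A.dW r x - ∑ i ∈ Finset.Ico 1 r, A.dW i (A.zOp (r - i) x) := by
  simp [diffPart, LinearMap.sum_apply]

theorem zOp_apply {j : ℕ} (hj : 1 ≤ j) (x : Forms E G) :
    A.zOp j x = A.d0inv (A.diffPart j x) := by
  have hrec : A.zOp j = A.d0inv * A.diffPart j :=
    (altCompositionSum_eq_sub (𝕜 := ℝ) (fun i => A.d0inv * A.dW i) hj).trans
      (by simp only [diffPart, mul_sub, Finset.mul_sum, ← mul_assoc]; rfl)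
  rw [hrec, Module.End.mul_apply]

theorem wproj_add_d_of_wproj_eq_neg {p : ℤ} {m : ℕ} (hm : 1 ≤ m) {X : Forms E G}
    {z : ℕ → Forms E G} (hX : X ∈ A.filtration p)
    (hz : ∀ j, 1 ≤ j → j < m → A.wproj (p + j) X = -z j) :
    A.wproj (p + m) (d E G X) =
      A.dW m (A.wproj p X) - ∑ i ∈ Finset.Ico 1 m, A.dW i (z (m - i)) +
        A.dW 0 (A.wproj (p + m) X) := by
  have hmid : ∑ i ∈ Finset.Ico 1 m, A.dW i (A.wproj (p + (m - i : ℕ)) X) =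
      -∑ i ∈ Finset.Ico 1 m, A.dW i (z (m - i)) := by
    rw [← Finset.sum_neg_distrib]
    refine Finset.sum_congr rfl fun i hi => ?_
    rw [Finset.mem_Ico] at hi
    rw [hz (m - i) (by omega) (by omega), map_neg]
  rw [A.wproj_add_d m hX, Finset.sum_range_succ, Finset.range_eq_Ico,
    Finset.sum_eq_sum_Ico_succ_bot hm, hmid, Nat.sub_zero, Nat.sub_self, Nat.cast_zero, add_zero]
  abel

section PureWeight
variable {p : ℤ} {x : Forms E G} (hx : x ∈ A.weightForms p)
include hx

theorem P_mem_filtration_of_mem_weightForms : A.P x ∈ A.filtration p :=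
  apply_mem_of_mem_shiftEnd A.P_mem_shiftEnd (add_zero p) (A.weightForms_le_filtration p hx)

theorem wproj_P_of_mem_weightForms : A.wproj p (A.P x) = x := by
  rw [A.wproj_P_of_mem_filtration (A.weightForms_le_filtration p hx), A.mem_weightForms.1 hx]

theorem wproj_add_P {m : ℕ} (hm : 1 ≤ m) : A.wproj (p + m) (A.P x) = -A.zOp m x := by
  induction m using Nat.strong_induction_on with
  | _ m ih =>
    have hd := A.wproj_add_d_of_wproj_eq_neg hm (A.P_mem_filtration_of_mem_weightForms hx)
      fun j hj hjm => ih j hjm hj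
    rw [A.wproj_P_of_mem_weightForms hx, ← diffPart_apply] at hd
    have hNP : A.wproj (p + m) (A.nilOp (A.P x)) = A.zOp m x := by
      rw [nilOp, Module.End.mul_apply, wproj_d0inv, LinearMap.sub_apply, map_sub, wproj_dW_zero,
        hd, add_sub_cancel_right, zOp_apply A hm]
    rw [P_eq_sub_nilOp_mul_P, LinearMap.sub_apply, map_sub, Module.End.mul_apply, hNP,
      Module.End.one_apply, A.wproj_of_mem_weightForms hx, if_neg (by omega), zero_sub]

theorem wproj_add_d_P {r : ℕ} (hr : 1 ≤ r) :
    A.wproj (p + r) (d E G (A.P x)) = A.diffPart r x - A.dW 0 (A.zOp r x) := by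
  rw [A.wproj_add_d_of_wproj_eq_neg hr (A.P_mem_filtration_of_mem_weightForms hx)
    fun j hj _ => A.wproj_add_P hx hj, A.wproj_P_of_mem_weightForms hx, A.wproj_add_P hx hr,
    ← diffPart_apply, map_neg, sub_eq_add_neg]

variable (hE : x ∈ A.ruminForms)
include hE

theorem wproj_add_dc {r : ℕ} (hr : 1 ≤ r) :
    A.wproj (p + r) (A.dc x) = A.projE0 (A.diffPart r x) := by
  rw [A.dc_of_mem_ruminForms hE, wproj_projE0, A.wproj_add_d_P hx hr, map_sub, projE0_dW_zero,
    sub_zero]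

theorem dc_mem_filtration_succ : A.dc x ∈ A.filtration (p + 1) := by
  have hP := A.P_mem_filtration_of_mem_weightForms hx
  rw [A.dc_of_mem_ruminForms hE]
  refine A.mem_filtration_succ (apply_mem_of_mem_shiftEnd A.projE0_mem_shiftEnd (add_zero p)
    (A.d_mem_filtration hP)) ?_
  have hd : A.wproj p (d E G (A.P x)) = A.dW 0 (A.wproj p (A.P x)) := by
    simpa using A.wproj_add_d 0 hP
  rw [wproj_projE0, hd, projE0_dW_zero]

end PureWeight

theorem dc_eq_sum_of_mem_weightForms {N a : ℕ} (hN : A.homDim ≤ N) {α : Forms E G}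
    (ha : α ∈ A.weightForms a) (hα : α ∈ A.ruminForms) :
    A.dc α = A.projE0 (∑ r ∈ Finset.Icc 1 N, A.diffPart r α) := by
  have hcomp := A.sum_wproj_add (N := N) (by omega) (A.dc_mem_filtration_succ ha hα)
  rw [Finset.sum_range_succ, A.wproj_eq_zero (Or.inr (by omega)), add_zero] at hcomp
  rw [← hcomp, map_sum, ← Finset.Ico_add_one_right_eq_Icc, Finset.sum_Ico_eq_sum_range,
    Nat.add_sub_cancel]
  refine Finset.sum_congr rfl fun r _ => ?_
  rw [← A.wproj_add_dc ha hα (Nat.le_add_right 1 r), Nat.cast_add, Nat.cast_one, add_assoc]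

theorem dc_eq_sum {N : ℕ} (hN : A.homDim ≤ N) {α : Forms E G} (hα : α ∈ A.ruminForms) :
    A.dc α = A.projE0 (∑ r ∈ Finset.Icc 1 N, A.diffPart r α) := by
  rw [← LinearMap.sum_apply, ← A.sum_wproj α]
  simp only [map_sum]
  refine Finset.sum_congr rfl fun a _ => ?_
  rw [A.dc_eq_sum_of_mem_weightForms hN (A.wproj_mem_weightForms _ _)
    (A.wproj_mem_ruminForms _ hα), LinearMap.sum_apply]

end AdaptedBasis
end RuminDifferential

section WeightSpectralSequence
variable {E : Type*} [NormedAddCommGroup E] [NormedSpace ℝ E]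
  {G : Type*} [TopologicalSpace G] [ChartedSpace E G]
  [FiniteDimensional ℝ E] [Group G] [LieGroup 𝓘(ℝ, E) ∞ G]

namespace AdaptedBasis
variable {S : Stratification E G} {n : ℕ} (A : AdaptedBasis S n) {r : ℕ} {p : ℤ}

section Zigzag
variable {x : Forms E G} {z : ℕ → Forms E G}

theorem isZigzag_iff : A.IsZigzag r p x z ↔
    (∀ j, 1 ≤ j → j < r → z j ∈ A.weightForms (p + j)) ∧ A.dW 0 x = 0 ∧
      ∀ m, 1 ≤ m → m < r →
        A.dW 0 (z m) = A.dW m x - ∑ i ∈ Finset.Ico 1 m, A.dW i (z (m - i)) := by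
  refine and_congr_right' (and_congr_right' (forall_congr' fun m => forall₂_congr fun hm _ => ?_))
  rw [Finset.range_eq_Ico, Finset.sum_eq_sum_Ico_succ_bot hm, Nat.sub_zero, zero_add,
    eq_sub_iff_add_eq, eq_comm]

theorem isZigzag_of_wproj_eq_neg (hr : 1 ≤ r) {X : Forms E G}
    (hX : X ∈ cycles (d E G) A.filtration r p)
    (hz : ∀ j, 1 ≤ j → j < r → A.wproj (p + j) X = -z j) : A.IsZigzag r p (A.wproj p X) z := by
  have hd := (A.mem_filtration_add_iff (A.d_mem_filtration hX.1)).1 hX.2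
  refine A.isZigzag_iff.2 ⟨fun j hj hjr => ?_, ?_, fun m hm hmr => ?_⟩
  · exact neg_mem_iff.1 (hz j hj hjr ▸ A.wproj_mem_weightForms _ X)
  · simpa using (A.wproj_add_d 0 hX.1).symm.trans (hd 0 hr)
  · have hdm := A.wproj_add_d_of_wproj_eq_neg hm hX.1 fun j hj hjm => hz j hj (hjm.trans hmr)
    rw [hd m hmr, hz m hm hmr, map_neg] at hdm
    exact (add_neg_eq_zero.1 hdm.symm).symm

theorem wproj_mem_Z (hr : 1 ≤ r) {X : Forms E G} (hX : X ∈ cycles (d E G) A.filtration r p) :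
    A.wproj p X ∈ A.Z r p :=
  ⟨A.wproj_mem_weightForms _ _, fun j => -A.wproj (p + j) X,
    A.isZigzag_of_wproj_eq_neg hr hX fun _ _ _ => (neg_neg _).symm⟩

/-- The cycle with leading component `x` that a solution `z` of the zigzag equations provides. -/
def zigzagLift (r : ℕ) (x : Forms E G) (z : ℕ → Forms E G) : Forms E G :=
  x - ∑ k ∈ Finset.Ico 1 r, z k

variable {A} (hx : x ∈ A.weightForms p) (H : A.IsZigzag r p x z)
include hx H

theorem zigzagLift_mem_filtration : zigzagLift r x z ∈ A.filtration p := by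
  refine sub_mem (A.weightForms_le_filtration p hx) (sum_mem fun k hk => ?_)
  obtain ⟨hk1, hkr⟩ := Finset.mem_Ico.1 hk
  exact A.filtration_antitone (by omega) (A.weightForms_le_filtration _ (H.1 k hk1 hkr))

theorem wproj_zigzagLift (j : ℕ) :
    A.wproj (p + j) (zigzagLift r x z) = if j = 0 then x else if j < r then -z j else 0 := by
  have hz : ∀ k ∈ Finset.Ico 1 r, A.wproj (p + j) (z k) = if j = k then z k else 0 := by
    intro k hk
    obtain ⟨hk1, hkr⟩ := Finset.mem_Ico.1 hk
    simp [A.wproj_of_mem_weightForms (H.1 k hk1 hkr)]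
  rw [zigzagLift, map_sub, map_sum, Finset.sum_congr rfl hz, A.wproj_of_mem_weightForms hx,
    Finset.sum_ite_eq]
  by_cases h0 : j = 0 <;> by_cases hj : j < r <;> simp [h0, hj, Nat.one_le_iff_ne_zero]

theorem wproj_zigzagLift_self : A.wproj p (zigzagLift r x z) = x := by
  simpa using wproj_zigzagLift hx H 0

theorem wproj_add_d_zigzagLift {m : ℕ} (hm : 1 ≤ m) (hmr : m ≤ r) :
    A.wproj (p + m) (d E G (zigzagLift r x z)) =
      A.dW m x - ∑ i ∈ Finset.Ico 1 m, A.dW i (z (m - i)) +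
        A.dW 0 (A.wproj (p + m) (zigzagLift r x z)) := by
  rw [A.wproj_add_d_of_wproj_eq_neg hm (zigzagLift_mem_filtration hx H) fun j hj hjm => ?_,
    wproj_zigzagLift_self hx H]
  rw [wproj_zigzagLift hx H, if_neg (by omega), if_pos (by omega)]

theorem zigzagLift_mem_cycles : zigzagLift r x z ∈ cycles (d E G) A.filtration r p := by
  have hF := zigzagLift_mem_filtration hx H
  refine ⟨hF, (A.mem_filtration_add_iff (A.d_mem_filtration hF)).2 fun m hmr => ?_⟩
  rcases Nat.eq_zero_or_pos m with rfl | hm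
  · rw [A.wproj_add_d 0 hF]
    simpa [wproj_zigzagLift_self hx H] using H.2.1
  · rw [wproj_add_d_zigzagLift hx H hm hmr.le, ← (A.isZigzag_iff.1 H).2.2 m hm hmr,
      wproj_zigzagLift hx H, if_neg (by omega), if_pos hmr, map_neg, add_neg_cancel]

theorem wproj_d_zigzagLift (hr : 1 ≤ r) :
    A.wproj (p + r) (d E G (zigzagLift r x z)) =
      A.dW r x - ∑ i ∈ Finset.Ico 1 r, A.dW i (z (r - i)) := by
  rw [wproj_add_d_zigzagLift hx H hr le_rfl, wproj_zigzagLift hx H, if_neg (by omega),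
    if_neg (lt_irrefl r), map_zero, add_zero]

end Zigzag

theorem wproj_sub_d {s l : ℕ} (hl : l ≤ s) {c : Forms E G} (hc : c ∈ A.filtration (p - s)) :
    A.wproj (p - l) (d E G c) =
      ∑ k ∈ Finset.Ico l (s + 1), A.dW (k - l) (A.wproj (p - k) c) := by
  have hpl : p - (l : ℤ) = p - s + (s - l : ℕ) := by omega
  rw [hpl, A.wproj_add_d _ hc, Finset.sum_Ico_eq_sum_range, Nat.succ_sub hl]
  refine Finset.sum_congr rfl fun i hi => ?_
  rw [Finset.mem_range] at hi
  rw [Nat.add_sub_cancel_left]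
  congr 3
  omega

theorem wproj_d_eq_sum_range {s : ℕ} {c : Forms E G} (hc : c ∈ A.filtration (p - s)) :
    A.wproj p (d E G c) = ∑ k ∈ Finset.range (s + 1), A.dW k (A.wproj (p - k) c) := by
  simpa using A.wproj_sub_d (Nat.zero_le s) hc

theorem wproj_mem_B {s : ℕ} {x : Forms E G}
    (hx : x ∈ boundaries (d E G) A.filtration (s + 1) p) : A.wproj p x ∈ A.B (s + 1) p := by
  obtain ⟨u, hu, v, ⟨c, hc, rfl⟩, rfl⟩ := Submodule.mem_sup.1 hx
  rw [map_add, A.mem_filtration.1 hu.1 p (by omega), zero_add]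
  refine ⟨fun k => A.wproj (p - k) c, fun k _ => A.wproj_mem_weightForms _ _,
    A.wproj_d_eq_sum_range hc.1, fun l hl hls => ?_⟩
  rw [← A.wproj_sub_d (by omega) hc.1]
  exact (A.mem_filtration.1 hc.2 _ (by omega)).symm

theorem exists_mem_cycles_wproj_d_eq {s : ℕ} {x : Forms E G} (hx : x ∈ A.B (s + 1) p) :
    ∃ c ∈ cycles (d E G) A.filtration s (p - s), A.wproj p (d E G c) = x := by
  obtain ⟨c, hc, rfl, hrel⟩ := hx
  have hF : ∑ k ∈ Finset.range (s + 1), c k ∈ A.filtration (p - s) := by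
    refine sum_mem fun k hk => ?_
    rw [Finset.mem_range] at hk
    exact A.filtration_antitone (by omega) (A.weightForms_le_filtration _ (hc k hk))
  refine ⟨_, ⟨hF, (A.mem_filtration_add_iff (A.d_mem_filtration hF)).2 fun m hm => ?_⟩, ?_⟩
  · have hpm : p - (s : ℤ) + m = p - (s - m : ℕ) := by omega
    rw [hpm, A.wproj_sub_d (by omega) hF, hrel (s - m) (by omega) (by omega)]
    refine Finset.sum_congr rfl fun k hk => ?_
    rw [A.wproj_sub_sum_range hc (Finset.mem_Ico.1 hk).2]
  · rw [A.wproj_d_eq_sum_range hF]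
    refine Finset.sum_congr rfl fun k hk => ?_
    rw [A.wproj_sub_sum_range hc (Finset.mem_range.1 hk)]

theorem mem_boundaries_of_wproj_mem_B {s : ℕ} {x : Forms E G}
    (hx : x ∈ cycles (d E G) A.filtration (s + 1) p) (hB : A.wproj p x ∈ A.B (s + 1) p) :
    x ∈ boundaries (d E G) A.filtration (s + 1) p := by
  obtain ⟨c, hc, hcx⟩ := A.exists_mem_cycles_wproj_d_eq hB
  have hdc : d E G c ∈ A.filtration p := by simpa using hc.2
  have hsub : x - d E G c ∈ cycles (d E G) A.filtration s (p + 1) := by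
    refine mem_cycles.2 ⟨A.mem_filtration_succ (sub_mem hx.1 hdc) ?_, ?_⟩
    · rw [map_sub, hcx, sub_self]
    · rw [map_sub, d_d, sub_zero]
      exact A.filtration_antitone (by push_cast; omega) hx.2
  exact Submodule.mem_sup.2 ⟨_, hsub, d E G c, ⟨c, hc, rfl⟩, sub_add_cancel _ _⟩

theorem wproj_mem_B_iff (hr : 1 ≤ r) {x : Forms E G}
    (hx : x ∈ cycles (d E G) A.filtration r p) :
    A.wproj p x ∈ A.B r p ↔ x ∈ boundaries (d E G) A.filtration r p := by
  obtain ⟨s, rfl⟩ := Nat.exists_eq_add_of_le' hr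
  exact ⟨A.mem_boundaries_of_wproj_mem_B hx, A.wproj_mem_B⟩

/-- The map `E_r^{p,*} → Z_r^{p,*} / B_r^{p,*}`, `[x] ↦ [(x)_p]`. -/
def pageMap (hr : 1 ≤ r) (p : ℤ) : A.specPage r p →ₗ[ℝ] A.ZB r p :=
  Submodule.mapQ _ _ ((A.wproj p).restrict fun _ hx => A.wproj_mem_Z hr hx)
    fun x hx => (A.wproj_mem_B_iff hr x.2).2 hx

theorem pageMap_cls (hr : 1 ≤ r) {x : Forms E G} (hx : x ∈ cycles (d E G) A.filtration r p) :
    A.pageMap hr p (cls _ _ x hx) = cls _ _ (A.wproj p x) (A.wproj_mem_Z hr hx) := rfl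

theorem pageMap_injective (hr : 1 ≤ r) (p : ℤ) : Function.Injective (A.pageMap hr p) := by
  refine (injective_iff_map_eq_zero _).2 fun ξ hξ => ?_
  obtain ⟨⟨x, hx⟩, rfl⟩ := Submodule.Quotient.mk_surjective _ ξ
  have hB : A.wproj p x ∈ A.B r p := (Submodule.Quotient.mk_eq_zero ((A.B r p).submoduleOf _)).1 hξ
  exact (Submodule.Quotient.mk_eq_zero _).2 ((A.wproj_mem_B_iff hr hx).1 hB)

theorem pageMap_surjective (hr : 1 ≤ r) (p : ℤ) : Function.Surjective (A.pageMap hr p) := by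
  intro ξ
  obtain ⟨⟨x, hx, z, H⟩, rfl⟩ := Submodule.Quotient.mk_surjective _ ξ
  exact ⟨cls _ _ _ (zigzagLift_mem_cycles hx H), cls_congr (wproj_zigzagLift_self hx H)⟩

/-- The isomorphism `E_r^{p,*} ≅ Z_r^{p,*} / B_r^{p,*}`, `[x] ↦ [(x)_p]`. -/
def pageEquiv (hr : 1 ≤ r) (p : ℤ) : A.specPage r p ≃ₗ[ℝ] A.ZB r p :=
  LinearEquiv.ofBijective (A.pageMap hr p) ⟨A.pageMap_injective hr p, A.pageMap_surjective hr p⟩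

theorem pageEquiv_cls (hr : 1 ≤ r) {x : Forms E G} (hx : x ∈ cycles (d E G) A.filtration r p) :
    A.pageEquiv hr p (cls _ _ x hx) = cls _ _ (A.wproj p x) (A.wproj_mem_Z hr hx) := rfl

theorem exists_partialD_cls_eq (hr : 1 ≤ r) {X x y : Forms E G}
    (hX : X ∈ cycles (d E G) A.filtration r p) (hx : A.wproj p X = x)
    (hy : A.wproj (p + r) (d E G X) = y) :
    ∃ (hx' : x ∈ A.Z r p) (hy' : y ∈ A.Z r (p + r)),
      A.partialD r (A.pageEquiv hr) p (cls _ _ x hx') = cls _ _ y hy' := by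
  subst hx hy
  have hdX := map_cycles (d E G) d_d A.filtration r p X hX
  refine ⟨A.wproj_mem_Z hr hX, A.wproj_mem_Z hr hdX, ?_⟩
  rw [← pageEquiv_cls A hr hX, partialD, LinearMap.comp_apply, LinearMap.comp_apply,
    LinearEquiv.coe_coe, LinearEquiv.coe_coe, LinearEquiv.symm_apply_apply]
  rfl

theorem exists_partialD_cls_eq_of_isZigzag (hr : 1 ≤ r) {x : Forms E G} {z : ℕ → Forms E G}
    (hx : x ∈ A.weightForms p) (H : A.IsZigzag r p x z) :
    ∃ (hx : x ∈ A.Z r p)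
      (hy : A.dW r x - ∑ i ∈ Finset.Ico 1 r, A.dW i (z (r - i)) ∈ A.Z r (p + r)),
      A.partialD r (A.pageEquiv hr) p (cls _ _ x hx) = cls _ _ _ hy :=
  A.exists_partialD_cls_eq hr (zigzagLift_mem_cycles hx H) (wproj_zigzagLift_self hx H)
    (wproj_d_zigzagLift hx H hr)

variable {A} in
theorem IsZigzag.eq_zOp {x : Forms E G} {z : ℕ → Forms E G} (H : A.IsZigzag r p x z)
    (ho : ∀ j, 1 ≤ j → j < r → ∀ κ, A.dW 0 κ = 0 → A.Ortho (z j) κ) {j : ℕ} (hj : 1 ≤ j)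
    (hjr : j < r) : z j = A.zOp j x := by
  induction j using Nat.strong_induction_on with
  | _ j ih =>
    have hsum : ∑ i ∈ Finset.Ico 1 j, A.dW i (z (j - i)) =
        ∑ i ∈ Finset.Ico 1 j, A.dW i (A.zOp (j - i) x) := by
      refine Finset.sum_congr rfl fun i hi => ?_
      rw [Finset.mem_Ico] at hi
      rw [ih (j - i) (by omega) (by omega) (by omega)]
    rw [← A.d0inv_dW_zero_of_ortho (ho j hj hjr), (A.isZigzag_iff.1 H).2.2 j hj hjr, hsum,
      ← diffPart_apply, A.zOp_apply hj]

theorem exists_partialD_cls_eq_diffPart (hr : 1 ≤ r) {x : Forms E G} {z : ℕ → Forms E G}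
    (hx : x ∈ A.weightForms p) (H : A.IsZigzag r p x z)
    (hz : ∀ j, 1 ≤ j → j < r → z j = A.zOp j x) :
    ∃ (hx : x ∈ A.Z r p) (hy : A.diffPart r x ∈ A.Z r (p + r)),
      A.partialD r (A.pageEquiv hr) p (cls _ _ x hx) = cls _ _ _ hy := by
  have hD : A.dW r x - ∑ i ∈ Finset.Ico 1 r, A.dW i (z (r - i)) = A.diffPart r x := by
    rw [diffPart_apply]
    refine congrArg _ (Finset.sum_congr rfl fun i hi => ?_)
    rw [Finset.mem_Ico] at hi
    rw [hz (r - i) (by omega) (by omega)]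
  exact hD ▸ A.exists_partialD_cls_eq_of_isZigzag hr hx H

theorem zOp_ortho {j : ℕ} (hj : 1 ≤ j) (x : Forms E G) {κ : Forms E G} (hκ : A.dW 0 κ = 0) :
    A.Ortho (A.zOp j x) κ :=
  A.zOp_apply hj x ▸ A.ortho_d0inv _ hκ

section RuminLift
variable {y : Forms E G} (hy : y ∈ A.ruminForms)
include hy

theorem P_mem_cycles (hp : y ∈ A.filtration p) (hdc : A.dc y ∈ A.filtration (p + r)) :
    A.P y ∈ cycles (d E G) A.filtration r p :=
  mem_cycles.2 ⟨apply_mem_of_mem_shiftEnd A.P_mem_shiftEnd (add_zero p) hp,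
    A.P_dc hy ▸ apply_mem_of_mem_shiftEnd A.P_mem_shiftEnd (add_zero _) hdc⟩

theorem isZigzag_zOp (hr : 1 ≤ r) (hp : y ∈ A.weightForms p)
    (hdc : A.dc y ∈ A.filtration (p + r)) : A.IsZigzag r p y (fun j => A.zOp j y) := by
  have hPy := A.P_mem_cycles hy (A.weightForms_le_filtration p hp) hdc
  have H := A.isZigzag_of_wproj_eq_neg hr hPy fun j hj _ => A.wproj_add_P hp hj
  rwa [A.wproj_P_of_mem_weightForms hp] at H

theorem exists_partialD_cls_eq_dc (hr : 1 ≤ r) (hp : y ∈ A.filtration p)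
    (hdc : A.dc y ∈ A.filtration (p + r)) :
    ∃ (hx : A.wproj p y ∈ A.Z r p) (hy : A.wproj (p + r) (A.dc y) ∈ A.Z r (p + r)),
      A.partialD r (A.pageEquiv hr) p (cls _ _ _ hx) = cls _ _ _ hy := by
  refine A.exists_partialD_cls_eq hr (A.P_mem_cycles hy hp hdc)
    (A.wproj_P_of_mem_filtration hp) ?_
  rw [← A.P_dc hy, A.wproj_P_of_mem_filtration hdc]

end RuminLift

theorem sub_projE_mem_boundaries (hr : 1 ≤ r) {X : Forms E G}
    (hX : X ∈ cycles (d E G) A.filtration r p) :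
    X - A.projE X ∈ boundaries (d E G) A.filtration r p := by
  obtain ⟨s, rfl⟩ := Nat.exists_eq_add_of_le' hr
  have hK : A.P * A.d0inv ∈ shiftEnd A.filtration 0 :=
    mul_mem_shiftEnd A.P_mem_shiftEnd A.d0inv_mem_shiftEnd (add_zero 0)
  convert homotopy_mem_boundaries_succ A.filtration_antitone A.d_mem_shiftEnd hK hX using 1
  simp only [projE, LinearMap.sub_apply, Module.End.mul_apply, Module.End.one_apply]
  abel

theorem projE_mem_cycles (hr : 1 ≤ r) {X : Forms E G}
    (hX : X ∈ cycles (d E G) A.filtration r p) : A.projE X ∈ cycles (d E G) A.filtration r p := by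
  have hb := A.sub_projE_mem_boundaries hr hX
  obtain ⟨s, rfl⟩ := Nat.exists_eq_add_of_le' hr
  exact (Submodule.sub_mem_iff_right _ hX).1
    (boundaries_succ_le_cycles d_d A.filtration_antitone s p hb)

theorem exists_ruminForms_cls_eq (hr : 1 ≤ r) (p : ℤ) (ξ : A.ZB r p) :
    ∃ y ∈ A.ruminForms ⊓ A.filtration p, A.dc y ∈ A.filtration (p + r) ∧
      ∃ hx : A.wproj p y ∈ A.Z r p, ξ = cls _ _ _ hx := by
  obtain ⟨ξ, rfl⟩ := A.pageMap_surjective hr p ξ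
  obtain ⟨⟨X, hX⟩, rfl⟩ := Submodule.Quotient.mk_surjective _ ξ
  have hY := A.projE_mem_cycles hr hX
  have hE := A.projE0_mem_ruminForms (A.projE X)
  have hF : A.projE0 (A.projE X) ∈ A.filtration p :=
    apply_mem_of_mem_shiftEnd A.projE0_mem_shiftEnd (add_zero p) hY.1
  have hw : A.wproj p (A.projE0 (A.projE X)) = A.wproj p (A.projE X) := by
    rw [← A.wproj_P_of_mem_filtration hF, P_projE0_projE]
  refine ⟨_, ⟨hE, hF⟩, ?_, hw ▸ A.wproj_mem_Z hr hY,
    (A.pageMap_cls hr hX).trans (cls_eq_iff.2 ?_)⟩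
  · rw [A.dc_of_mem_ruminForms hE, P_projE0_projE]
    exact apply_mem_of_mem_shiftEnd A.projE0_mem_shiftEnd (add_zero _) hY.2
  · rw [hw, ← map_sub]
    exact (A.wproj_mem_B_iff hr (sub_mem hX hY)).2 (A.sub_projE_mem_boundaries hr hX)

end AdaptedBasis
end WeightSpectralSequence

end Carnot
end

theorem theorem4p7_general
    {E : Type*} [NormedAddCommGroup E] [NormedSpace ℝ E] [FiniteDimensional ℝ E]
    {G : Type*} [TopologicalSpace G] [ChartedSpace E G] [Group G]
    [LieGroup 𝓘(ℝ, E) ∞ G]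
    (S : Carnot.Stratification E G) {n : ℕ} (A : Carnot.AdaptedBasis S n) :
    (∀ α, A.projE0 α ∈ A.ruminForms) ∧
    (∀ h, ∀ α ∈ A.ruminForms ⊓ Carnot.Forms.degree h,
      A.dc α ∈ A.ruminForms ⊓ Carnot.Forms.degree (h + 1)) ∧
    A.nilOp ^ (A.homDim + 1) = 0 ∧
    (∀ N, A.homDim ≤ N → ∀ α ∈ A.ruminForms,
      A.dc α = A.projE0 (∑ r ∈ Finset.Icc 1 N, A.diffPart r α)) ∧
    (∀ r : ℕ, 1 ≤ r → ∀ p : ℤ, ∀ α ∈ A.ruminForms ⊓ A.weightForms p,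
      A.wproj (p + r) (A.dc α) = A.projE0 (A.diffPart r α)) ∧
    (∀ r : ℕ, 1 ≤ r → ∃ ψ : ∀ p : ℤ, A.specPage r p ≃ₗ[ℝ] A.ZB r p,
      (∀ (p : ℤ) (x : Carnot.Forms E G)
        (hx : x ∈ Carnot.cycles (Carnot.d E G) A.filtration r p),
        ∃ hx' : A.wproj p x ∈ A.Z r p,
          ψ p (Carnot.cls _ _ x hx) = Carnot.cls _ _ (A.wproj p x) hx') ∧
      (∀ (p : ℤ) (x : Carnot.Forms E G) (z : ℕ → Carnot.Forms E G),
        x ∈ A.weightForms p → A.IsZigzag r p x z →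
        ∃ (hx : x ∈ A.Z r p)
          (hy : A.dW r x - ∑ i ∈ Finset.Ico 1 r, A.dW i (z (r - i)) ∈ A.Z r (p + r)),
          A.partialD r ψ p (Carnot.cls _ _ x hx) = Carnot.cls _ _ _ hy) ∧
      (∀ (p : ℤ) (x : Carnot.Forms E G) (z : ℕ → Carnot.Forms E G),
        x ∈ A.weightForms p → A.IsZigzag r p x z →
        (∀ j, 1 ≤ j → j < r → ∀ κ, A.dW 0 κ = 0 → A.Ortho (z j) κ) →
        (∀ j, 1 ≤ j → j < r → z j = A.zOp j x) ∧
        ∃ (hx : x ∈ A.Z r p) (hy : A.diffPart r x ∈ A.Z r (p + r)),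
          A.partialD r ψ p (Carnot.cls _ _ x hx) = Carnot.cls _ _ _ hy) ∧
      (∀ (p : ℤ), ∀ α ∈ A.ruminForms ⊓ A.weightForms p, A.dc α ∈ A.filtration (p + r) →
        A.IsZigzag r p α (fun j => A.zOp j α) ∧
        (∀ j, 1 ≤ j → j < r → ∀ κ, A.dW 0 κ = 0 → A.Ortho (A.zOp j α) κ)) ∧
      (∀ (p : ℤ), ∀ y ∈ A.ruminForms ⊓ A.filtration p, A.dc y ∈ A.filtration (p + r) →
        ∃ (hx : A.wproj p y ∈ A.Z r p) (hy : A.wproj (p + r) (A.dc y) ∈ A.Z r (p + r)),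
          A.partialD r ψ p (Carnot.cls _ _ _ hx) = Carnot.cls _ _ _ hy) ∧
      (∀ (p : ℤ) (ξ : A.ZB r p), ∃ y ∈ A.ruminForms ⊓ A.filtration p,
        A.dc y ∈ A.filtration (p + r) ∧
        ∃ hx : A.wproj p y ∈ A.Z r p, ξ = Carnot.cls _ _ _ hx)) := by
  refine ⟨A.projE0_mem_ruminForms,
    fun h α hα => ⟨A.dc_mem_ruminForms α, A.dc_mem_degree_succ hα.2⟩,
    A.nilOp_pow_eq_zero, fun N hN α hα => A.dc_eq_sum hN hα,
    fun r hr p α hα => A.wproj_add_dc hα.2 hα.1 hr, fun r hr => ⟨A.pageEquiv hr,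
      fun p x hx => ⟨A.wproj_mem_Z hr hx, A.pageEquiv_cls hr hx⟩,
      fun p x z hx H => A.exists_partialD_cls_eq_of_isZigzag hr hx H, fun p x z hx H ho => ?_,
      fun p α hα hdc => ⟨A.isZigzag_zOp hα.1 hr hα.2 hdc, fun j hj _ κ hκ => A.zOp_ortho hj α hκ⟩,
      fun p y hy hdc => A.exists_partialD_cls_eq_dc hy.1 hr hy.2 hdc,
      A.exists_ruminForms_cls_eq hr⟩⟩
  have hz : ∀ j, 1 ≤ j → j < r → z j = A.zOp j x := fun j hj hjr => H.eq_zOp ho hj hjr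
  exact ⟨hz, A.exists_partialD_cls_eq_diffPart hr hx H hz⟩

theorem theorem4p7
    {E : Type*} [NormedAddCommGroup E] [NormedSpace ℝ E] [FiniteDimensional ℝ E]
    {G : Type*} [TopologicalSpace G] [ChartedSpace E G] [Group G]
    [LieGroup 𝓘(ℝ, E) ∞ G] [SimplyConnectedSpace G]
    (S : Carnot.Stratification E G) {n : ℕ} (A : Carnot.AdaptedBasis S n) :
    -- `Π_{E_0}` takes values in `E_0`, `d_c` maps `E_0^h` to `E_0^{h+1}`, and `d_0⁻¹ (d - d_0)` is
    -- nilpotent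
    (∀ α, A.projE0 α ∈ A.ruminForms) ∧
    (∀ h, ∀ α ∈ A.ruminForms ⊓ Carnot.Forms.degree h,
      A.dc α ∈ A.ruminForms ⊓ Carnot.Forms.degree (h + 1)) ∧
    A.nilOp ^ (A.homDim + 1) = 0 ∧
    -- `d_c = Π_{E_0} ∑_{r ≥ 1} D_r` on `E_0`, the `r`-th term being the part that raises the weight
    -- by `r`
    (∀ N, A.homDim ≤ N → ∀ α ∈ A.ruminForms,
      A.dc α = A.projE0 (∑ r ∈ Finset.Icc 1 N, A.diffPart r α)) ∧
    (∀ r : ℕ, 1 ≤ r → ∀ p : ℤ, ∀ α ∈ A.ruminForms ⊓ A.weightForms p,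
      A.wproj (p + r) (A.dc α) = A.projE0 (A.diffPart r α)) ∧
    -- the spectral sequence: for `r ≥ 1`, `E_r ≅ Z_r / B_r` by `[x] ↦ [(x)_p]`, and, with
    -- `∂_r` the differential of the `r`-th page read in `Z_r / B_r`,
    (∀ r : ℕ, 1 ≤ r → ∃ ψ : ∀ p : ℤ, A.specPage r p ≃ₗ[ℝ] A.ZB r p,
      (∀ (p : ℤ) (x : Carnot.Forms E G)
        (hx : x ∈ Carnot.cycles (Carnot.d E G) A.filtration r p),
        ∃ hx' : A.wproj p x ∈ A.Z r p,
          ψ p (Carnot.cls _ _ x hx) = Carnot.cls _ _ (A.wproj p x) hx') ∧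
      -- `∂_r [x] = [d_r x - ∑ d_i z_{p+r-i}]`
      (∀ (p : ℤ) (x : Carnot.Forms E G) (z : ℕ → Carnot.Forms E G),
        x ∈ A.weightForms p → A.IsZigzag r p x z →
        ∃ (hx : x ∈ A.Z r p)
          (hy : A.dW r x - ∑ i ∈ Finset.Ico 1 r, A.dW i (z (r - i)) ∈ A.Z r (p + r)),
          A.partialD r ψ p (Carnot.cls _ _ x hx) = Carnot.cls _ _ _ hy) ∧
      -- if the `z_{p+j}` are orthogonal to `ker d_0`, they are given by `d_0⁻¹` and the `d_i`, and
      -- `∂_r [x] = [D_r x]`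
      (∀ (p : ℤ) (x : Carnot.Forms E G) (z : ℕ → Carnot.Forms E G),
        x ∈ A.weightForms p → A.IsZigzag r p x z →
        (∀ j, 1 ≤ j → j < r → ∀ κ, A.dW 0 κ = 0 → A.Ortho (z j) κ) →
        (∀ j, 1 ≤ j → j < r → z j = A.zOp j x) ∧
        ∃ (hx : x ∈ A.Z r p) (hy : A.diffPart r x ∈ A.Z r (p + r)),
          A.partialD r ψ p (Carnot.cls _ _ x hx) = Carnot.cls _ _ _ hy) ∧
      -- this is the case for Rumin forms of weight `p` whose Rumin differential has weight at
      -- least `p + r`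
      (∀ (p : ℤ), ∀ α ∈ A.ruminForms ⊓ A.weightForms p, A.dc α ∈ A.filtration (p + r) →
        A.IsZigzag r p α (fun j => A.zOp j α) ∧
        (∀ j, 1 ≤ j → j < r → ∀ κ, A.dW 0 κ = 0 → A.Ortho (A.zOp j α) κ)) ∧
      -- all of `∂_r` is induced by `d_c`
      (∀ (p : ℤ), ∀ y ∈ A.ruminForms ⊓ A.filtration p, A.dc y ∈ A.filtration (p + r) →
        ∃ (hx : A.wproj p y ∈ A.Z r p) (hy : A.wproj (p + r) (A.dc y) ∈ A.Z r (p + r)),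
          A.partialD r ψ p (Carnot.cls _ _ _ hx) = Carnot.cls _ _ _ hy) ∧
      (∀ (p : ℤ) (ξ : A.ZB r p), ∃ y ∈ A.ruminForms ⊓ A.filtration p,
        A.dc y ∈ A.filtration (p + r) ∧
        ∃ hx : A.wproj p y ∈ A.Z r p, ξ = Carnot.cls _ _ _ hx)) :=
  theorem4p7_general S A
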